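/- **Theorem.** For $0<q\le 1$ and complex $a,b$ read $\frac{1-q^{a}}{1-q^{b}}$ as its limiting value $\frac ab$ when $q=1$; infinite sums are limits of partial sums. Let $$f(x,q)=\sum_{n=0}^\infty(-1)^nq^n\prod_{j=1}^n\frac{(1-q^{2j-1}x)(1-q^{2j-1})}{(1-q^{2j})(1-q^{2j}x)},$$ where for $q=1$ the expression $f(q^{2s},q)$ denotes $\sum_{n\ge0}(-1)^n\prod_{j=1}^n\frac{(2j-1)(2s+2j-1)}{2j\,(2s+2j)}$ and $f(0,1)=\sum_{n\ge0}(-1)^n\prod_{j=1}^n\frac{2j-1}{2j}$. For $\alpha\in\mathbb C$ let $$(\alpha)!_q=\frac1{(1-q)^{\alpha}}\prod_{n=1}^\infty\frac{1-q^n}{1-q^{\alpha+n}}\quad(0<q<1),\qquad(\alpha)!_1=\Gamma(\alpha+1),$$ with $1/(\alpha)!_q=0$ at the poles, and let $$C_3(q)=\left(\frac{1-q^4}{1-q^2}\prod_{n=1}^\infty\frac{(1-q^{4n})^2}{(1-q^{4n-2})(1-q^{4n+2})}\right)^{1/2}.$$ (a) Let $q\in(0,1]$ and let $s\in\mathbb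 C$ not be a negative integer; if $q<1$, assume moreover that $q^{2s+2j}\ne1$ for every integer $j\ge1$. Then the series $f(0,q)$ and $f(q^{2s},q)$, the first product below and the product in $C_3(q)$ converge, and $$f(q^{2s},q)=f(0,q)\prod_{n=0}^\infty\frac{(1-q^{2s+4n+3})^2}{(1-q^{2s+4n+2})(1-q^{2s+4n+4})}=f(0,q)\,\frac{C_3(q)}{(1+q^2)^s}\,\frac{(s)!_{q^2}}{\left(\left(\frac{2s-1}4\right)!_{q^4}\right)^2}.$$ That is, $$\sum_{n=0}^\infty(-1)^nq^n\prod_{j=1}^n\frac{(1-q^{2j-1})(1-q^{2s+2j-1})}{(1-q^{2j})(1-q^{2s+2j})}=\left(\sum_{n=0}^\infty(-1)^nq^n\prod_{j=1}^n\frac{1-q^{2j-1}}{1-q^{2j}}\right)\prod_{n=0}^\infty\frac{(1-q^{2s+4n+3})^2}{(1-q^{2s+4n+2})(1-q^{2s+4n+4})}.$$ (b) $C_3(1)=\sqrt\pi=\lim_{q\to1^-}C_3(q)$ and $f(0,1)=\frac1{\sqrt2}$. (c) The series $f(q^{2s},q)$ is a $q$-analogue of the series that arises from the integral for the derivatives at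 $\frac12$ of the complete elliptic integral of the first kind: if $s$ is not a negative integer, each term of $f(q^{2s},q)$ tends, as $q\to1^-$, to the corresponding term of the series at $q=1$; and for $\operatorname{Re}s>-\frac12$ the following integral converges absolutely and $$\int_0^1\frac1{\sqrt{1-t^2}\sqrt{2-t^2}}\left(\frac{t^2}{2-t^2}\right)^s dt=\frac{\Gamma(\frac12)\Gamma(s+\frac12)}{2\,\Gamma(s+1)}\sum_{n=0}^\infty(-1)^n\prod_{j=1}^n\frac{(2j-1)(2s+2j-1)}{2j\,(2s+2j)}.$$ -/

import Mathlib

open Filter Topology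

noncomputable section

namespace QElliptic

/-- The quotient `(1 - q^a) / (1 - q^b)`, with its limiting value `a / b` at `q = 1`. -/
def qRatio (a b : ℂ) (q : ℝ) : ℂ :=
  if q = 1 then a / b else (1 - (q : ℂ) ^ a) / (1 - (q : ℂ) ^ b)

/-- The `n`-th term
`(-1)^n q^n ∏_{j=1}^n (1 - q^{2j-1} x) (1 - q^{2j-1}) / ((1 - q^{2j}) (1 - q^{2j} x))`
of the series `f(x,q)`. The product index is shifted, so that `2j-1` and `2j` become `2j+1` and
`2j+2` with `0 ≤ j < n`. At `q = 1` the factors free of `x` take their limiting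
values `(2j-1)/(2j)`; the term is then meaningful for every `x ≠ 1`, in particular for `x = 0`. -/
def fTerm (x : ℂ) (q : ℝ) (n : ℕ) : ℂ :=
  (-1) ^ n * (q : ℂ) ^ n * ∏ j ∈ Finset.range n,
    (1 - (q : ℂ) ^ (2 * j + 1) * x) / (1 - (q : ℂ) ^ (2 * j + 2) * x) *
      qRatio (2 * j + 1) (2 * j + 2) q

/-- The series `f(x,q)`, as the limit of its partial sums (for `q = 1` the convergence is only
conditional). -/
def f (x : ℂ) (q : ℝ) : ℂ :=
  limUnder atTop fun N : ℕ => ∑ n ∈ Finset.range N, fTerm x q n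

/-- The `n`-th term of `f(q^{2s},q)`: for `q ≠ 1` it is obtained by substituting `x = q^{2s}`; for
`q = 1` it is the limiting value `(-1)^n ∏_{j=1}^n (2j-1)(2s+2j-1) / ((2j)(2s+2j))`. -/
def fPowTerm (s : ℂ) (q : ℝ) (n : ℕ) : ℂ :=
  if q = 1 then
    (-1) ^ n * ∏ j ∈ Finset.range n,
      (2 * (j : ℂ) + 1) * (2 * s + 2 * j + 1) / ((2 * j + 2) * (2 * s + 2 * j + 2))
  else fTerm ((q : ℂ) ^ (2 * s)) q n

/-- `f(q^{2s},q)`, for `q = 1` understood as the sum of the limiting terms. -/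
def fPow (s : ℂ) (q : ℝ) : ℂ :=
  if q = 1 then limUnder atTop fun N : ℕ => ∑ n ∈ Finset.range N, fPowTerm s 1 n
  else f ((q : ℂ) ^ (2 * s)) q

/-- The `q`-factorial `(α)!_q = (1-q)^{-α} ∏_{n ≥ 1} (1 - q^n) / (1 - q^{α+n})` of a complex
number, and the ordinary factorial `α! = Γ(α+1)` at `q = 1`. At a pole of `(α)!_q` the value of
this function is `0`, so that its reciprocal is `0`, as it should be. -/
def qFactorial (α : ℂ) (q : ℝ) : ℂ :=
  if q = 1 then Complex.Gamma (α + 1)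
  else 1 / ((1 - q : ℝ) : ℂ) ^ α *
    ∏' n : ℕ, (1 - (q : ℂ) ^ (n + 1)) / (1 - (q : ℂ) ^ (α + (n + 1)))

/-- The `n`-th factor of the product in `C₃(q)`, with `n ≥ 1` shifted to `n ≥ 0`, and with its
limiting value at `q = 1`. -/
def C₃Factor (q : ℝ) (n : ℕ) : ℝ :=
  if q = 1 then (4 * n + 4) ^ 2 / ((4 * n + 2) * (4 * n + 6))
  else (1 - q ^ (4 * n + 4)) ^ 2 / ((1 - q ^ (4 * n + 2)) * (1 - q ^ (4 * n + 6)))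

/-- `C₃(q) = ((1-q⁴)/(1-q²) ∏_{n ≥ 1} (1-q^{4n})² / ((1-q^{4n-2}) (1-q^{4n+2})))^{1/2}`, with the
limiting value `4/2` of the first quotient at `q = 1`. -/
def C₃ (q : ℝ) : ℝ :=
  Real.sqrt ((if q = 1 then 4 / 2 else (1 - q ^ 4) / (1 - q ^ 2)) * ∏' n : ℕ, C₃Factor q n)

/-- The `n`-th factor
`(1 - q^{2s+4n+3})² / ((1 - q^{2s+4n+2}) (1 - q^{2s+4n+4}))` of the product evaluation. -/
def prodFactor (s : ℂ) (q : ℝ) (n : ℕ) : ℂ :=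
  qRatio (2 * s + 4 * n + 3) (2 * s + 4 * n + 2) q *
    qRatio (2 * s + 4 * n + 3) (2 * s + 4 * n + 4) q

end QElliptic

end

/-!
The product evaluation of `f(q^{2s},q)` is the Bailey–Daum theorem (to the base `q²`, with second
parameter `q`), and at `q = 1` Kummer's theorem for `₂F₁(1/2, s + 1/2; s + 1; -1)`. Both are
derived from a first-order recurrence. Let `t_n(x)` be the terms of `f(x,q)`. Then
`(1-q²x)(1-q⁴x) ∑_{n ≤ N} t_n(x) - (1-q³x)² ∑_{n ≤ N} t_n(q⁴x)` is an explicit bounded multiple of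
`t_N(q²x)` (`qTerm_sum_telescope`), which tends to `0`. Hence `f(x,q)` is
`(1-q³x)² / ((1-q²x)(1-q⁴x))` times `f(q⁴x,q)`, and iteration gives the product, since
`f(q^{4k}x,q) → f(0,q)` by dominated convergence (`qTerm_sum_eq`).

At `q = 1` the same relation connects `s` with `s + 2` (`oneTerm_sum_telescope`), but the series
converge only conditionally. For `Re s ≥ 0` Euler's transformation of alternating series replaces
them by series with a majorant independent of `s`, which gives the limit along `s + 2k`; the
recurrence then carries convergence and value back to every admissible `s` (`tendsto_oneTerm_sum`).
The product is a quotient of Gamma values by Gauss's limit formula, and the choice `s = -1/2`,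
where the series has only one term, gives `f(0,1) = 1/√2` (`centralCoeff_sum_eq`).

The second evaluation rewrites the product: for `q < 1` by separating even and odd factors of
`q`-Pochhammer symbols to the base `q²` (`tprod_prodFactor_lt_one`), for `q = 1` by the duplication
formula (`gammaProd_eq`). The limit of `C₃(q)` is dominated convergence for infinite products, with
the factors at `q = 1` as majorant (`C₃Factor_bounds`), and its value is Wallis's product. The
elliptic integral becomes `B(s/2 + 1/4, 1/2) / 4` under `v = (t²/(2-t²))²`, so that it suffices to
compare Gamma values (`integral_ellipticIntegrand_eq_fPow`).
-/

noncomputable section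

namespace QElliptic

/-! ### Contiguous relations, summed -/

/-- The `n`-th term of `f(x,q)` for `q ≠ 1`, with complex `q` and with natural-number powers in place
of complex ones. -/
def qTerm (q x : ℂ) (n : ℕ) : ℂ :=
  (-1) ^ n * q ^ n * ∏ j ∈ Finset.range n,
    ((1 - q ^ (2 * j + 1) * x) / (1 - q ^ (2 * j + 2) * x) *
      ((1 - q ^ (2 * j + 1)) / (1 - q ^ (2 * j + 2))))

theorem qTerm_succ (q x : ℂ) (n : ℕ) :
    qTerm q x (n + 1) = qTerm q x n * (-q * ((1 - q ^ (2 * n + 1) * x) / (1 - q ^ (2 * n + 2) * x) *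
      ((1 - q ^ (2 * n + 1)) / (1 - q ^ (2 * n + 2))))) := by
  rw [qTerm, qTerm, Finset.prod_range_succ]
  ring

theorem one_sub_pow_ne_zero {q : ℂ} (hq : ‖q‖ < 1) (m : ℕ) (hm : m ≠ 0) : 1 - q ^ m ≠ 0 := by
  intro h
  have h1 : ‖q ^ m‖ < 1 := by
    rw [norm_pow]
    exact pow_lt_one₀ (norm_nonneg _) hq hm
  rw [← sub_eq_zero.mp h, norm_one] at h1
  exact lt_irrefl _ h1

/-- The terms at `x` and at `q⁴x` are both expressed through those at `q²x`, because their quotient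
has the denominator `(1 - q x) (1 - q³ x)`, which may vanish. -/
theorem qTerm_succ_eq_shift {q x : ℂ} (hq : ‖q‖ < 1)
    (hx : ∀ j : ℕ, 1 - q ^ (2 * j + 2) * x ≠ 0) (n : ℕ) :
    qTerm q x (n + 1) = -q * (1 - q * x) * (1 - q ^ (2 * n + 1)) /
      ((1 - q ^ 2 * x) * (1 - q ^ (2 * n + 2))) * qTerm q (q ^ 2 * x) n := by
  induction n with
  | zero =>
    have h0 := hx 0
    have h3 := one_sub_pow_ne_zero hq 2 (by omega)
    norm_num at h0
    simp [qTerm]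
    field_simp
  | succ n ih =>
    have e0 : q ^ (2 * n + 1) * (q ^ 2 * x) = q ^ (2 * n + 3) * x := by ring
    have e0' : q ^ (2 * n + 2) * (q ^ 2 * x) = q ^ (2 * n + 4) * x := by ring
    rw [qTerm_succ, ih, qTerm_succ, e0, e0']
    have h0 := hx 0
    have h2 := hx (n + 1)
    have h3 := one_sub_pow_ne_zero hq (2 * n + 2) (by omega)
    have h4 := one_sub_pow_ne_zero hq (2 * n + 4) (by omega)
    have e1 : 2 * (n + 1) + 1 = 2 * n + 3 := by ring
    have e2 : 2 * (n + 1) + 2 = 2 * n + 4 := by ring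
    clear ih
    simp only [e1, e2, Nat.mul_zero, Nat.zero_add] at h0 h2 h3 h4 ⊢
    generalize qTerm q (q ^ 2 * x) n = T
    field_simp

/-- The factor `1 - q³ x` on the left cancels a denominator that may vanish. -/
theorem qTerm_succ_shift_eq_shift {q x : ℂ} (hq : ‖q‖ < 1)
    (hx : ∀ j : ℕ, 1 - q ^ (2 * j + 2) * x ≠ 0) (n : ℕ) :
    (1 - q ^ 3 * x) * qTerm q (q ^ 4 * x) (n + 1) =
      -q * (1 - q ^ 4 * x) * (1 - q ^ (2 * n + 3) * x) * (1 - q ^ (2 * n + 5) * x) *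
        (1 - q ^ (2 * n + 1)) / ((1 - q ^ (2 * n + 4) * x) * (1 - q ^ (2 * n + 6) * x) *
          (1 - q ^ (2 * n + 2))) * qTerm q (q ^ 2 * x) n := by
  induction n with
  | zero =>
    have h1 := hx 1
    have h2 := hx 2
    have h3 := one_sub_pow_ne_zero hq 2 (by omega)
    have e0 : q * (q ^ 4 * x) = q ^ 5 * x := by ring
    have e0' : q ^ 2 * (q ^ 4 * x) = q ^ 6 * x := by ring
    simp [qTerm, e0, e0']
    norm_num at h1 h2
    field_simp
  | succ n ih =>
    have e0 : q ^ (2 * n + 1) * (q ^ 2 * x) = q ^ (2 * n + 3) * x := by ring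
    have e0' : q ^ (2 * n + 2) * (q ^ 2 * x) = q ^ (2 * n + 4) * x := by ring
    have e9 : q ^ (2 * n + 3) * (q ^ 4 * x) = q ^ (2 * n + 7) * x := by ring
    have e9' : q ^ (2 * n + 4) * (q ^ 4 * x) = q ^ (2 * n + 8) * x := by ring
    rw [qTerm_succ, ← mul_assoc, ih, qTerm_succ, e0, e0']
    have h1 := hx (n + 1)
    have h2 := hx (n + 2)
    have h6 := hx (n + 3)
    have h3 := one_sub_pow_ne_zero hq (2 * n + 2) (by omega)
    have h4 := one_sub_pow_ne_zero hq (2 * n + 4) (by omega)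
    have e1 : 2 * (n + 1) + 1 = 2 * n + 3 := by ring
    have e2 : 2 * (n + 1) + 2 = 2 * n + 4 := by ring
    have e3 : 2 * (n + 1) + 3 = 2 * n + 5 := by ring
    have e4 : 2 * (n + 1) + 4 = 2 * n + 6 := by ring
    have e5 : 2 * (n + 1) + 5 = 2 * n + 7 := by ring
    have e6 : 2 * (n + 1) + 6 = 2 * n + 8 := by ring
    have e7 : 2 * (n + 2) + 2 = 2 * n + 6 := by ring
    have e8 : 2 * (n + 3) + 2 = 2 * n + 8 := by ring
    clear ih
    simp only [e1, e2, e3, e4, e5, e6, e7, e8, e9, e9'] at h1 h2 h6 ⊢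
    generalize qTerm q (q ^ 2 * x) n = T
    generalize 1 - q ^ (2 * n + 4) * x = d1 at h1 ⊢
    generalize 1 - q ^ (2 * n + 6) * x = d2 at h2 ⊢
    generalize 1 - q ^ (2 * n + 8) * x = d3 at h6 ⊢
    generalize 1 - q ^ (2 * n + 2) = d4 at h3 ⊢
    generalize 1 - q ^ (2 * n + 4) = d5 at h4 ⊢
    field_simp

/-- The sum over `n ≤ N` of the first-order recurrence under `x ↦ q⁴x`; its remainder is an explicit
multiple of a single term at `q²x`. The recurrence holds only after summation over `n`: it is the
contiguous relation behind the Bailey–Daum evaluation. -/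
theorem qTerm_sum_telescope {q x : ℂ} (hq : ‖q‖ < 1)
    (hx : ∀ j : ℕ, 1 - q ^ (2 * j + 2) * x ≠ 0) (N : ℕ) :
    (1 - q ^ 2 * x) * (1 - q ^ 4 * x) * ∑ n ∈ Finset.range (N + 1), qTerm q x n -
        (1 - q ^ 3 * x) ^ 2 * ∑ n ∈ Finset.range (N + 1), qTerm q (q ^ 4 * x) n =
      -q ^ 2 * x * (1 - q) * (1 - q ^ 4 * x) * (1 - q ^ (2 * N + 1)) / (1 - q ^ (2 * N + 4) * x) *
        qTerm q (q ^ 2 * x) N := by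
  induction N with
  | zero =>
    have h1 := hx 1
    norm_num at h1
    simp [qTerm]
    field_simp
    ring
  | succ N ih =>
    have e0 : q ^ (2 * N + 1) * (q ^ 2 * x) = q ^ (2 * N + 3) * x := by ring
    have e0' : q ^ (2 * N + 2) * (q ^ 2 * x) = q ^ (2 * N + 4) * x := by ring
    rw [Finset.sum_range_succ, Finset.sum_range_succ _ (N + 1), mul_add, mul_add,
      pow_two (1 - q ^ 3 * x), mul_assoc _ _ (qTerm q (q ^ 4 * x) (N + 1)),
      qTerm_succ_shift_eq_shift hq hx, add_sub_add_comm, ← pow_two, ih, qTerm_succ_eq_shift hq hx,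
      qTerm_succ, e0, e0']
    have h0 := hx 0
    have h1 := hx (N + 1)
    have h2 := hx (N + 2)
    have h3 := one_sub_pow_ne_zero hq (2 * N + 2) (by omega)
    have e1 : 2 * (N + 1) + 1 = 2 * N + 3 := by ring
    have e2 : 2 * (N + 1) + 2 = 2 * N + 4 := by ring
    have e4 : 2 * (N + 1) + 4 = 2 * N + 6 := by ring
    have e7 : 2 * (N + 2) + 2 = 2 * N + 6 := by ring
    clear ih
    simp only [e1, e2, e4, e7, Nat.mul_zero, Nat.zero_add] at h0 h1 h2 h3 ⊢
    generalize qTerm q (q ^ 2 * x) N = T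
    generalize hd1 : 1 - q ^ (2 * N + 4) * x = d1 at h1 ⊢
    generalize hd2 : 1 - q ^ (2 * N + 6) * x = d2 at h2 ⊢
    generalize hd3 : 1 - q ^ (2 * N + 2) = d3 at h3 ⊢
    field_simp
    rw [← hd1, ← hd2, ← hd3]
    ring

/-- The `n`-th term of the series at `q = 1`, that is of `₂F₁(1/2, s + 1/2; s + 1; -1)`. -/
def oneTerm (s : ℂ) (n : ℕ) : ℂ :=
  (-1) ^ n * ∏ j ∈ Finset.range n,
    (2 * (j : ℂ) + 1) * (2 * s + 2 * j + 1) / ((2 * j + 2) * (2 * s + 2 * j + 2))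

theorem oneTerm_zero (s : ℂ) : oneTerm s 0 = 1 := by simp [oneTerm]

theorem oneTerm_succ (s : ℂ) (n : ℕ) :
    oneTerm s (n + 1) = oneTerm s n *
      -((2 * (n : ℂ) + 1) * (2 * s + 2 * n + 1) / ((2 * n + 2) * (2 * s + 2 * n + 2))) := by
  rw [oneTerm, oneTerm, Finset.prod_range_succ]
  ring

theorem two_mul_natCast_add_two_ne_zero (n : ℕ) : 2 * (n : ℂ) + 2 ≠ 0 := by
  exact_mod_cast (by omega : 2 * n + 2 ≠ 0)

theorem oneTerm_succ_eq_shift {s : ℂ} (hs : ∀ j : ℕ, 2 * s + 2 * j + 2 ≠ 0) (n : ℕ) :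
    oneTerm s (n + 1) = -(2 * s + 1) * (2 * n + 1) / ((2 * s + 2) * (2 * n + 2)) *
      oneTerm (s + 1) n := by
  induction n with
  | zero => simp [oneTerm]; ring
  | succ n ih =>
    rw [oneTerm_succ, ih, oneTerm_succ]
    have h0 := hs 0
    have h1 := hs (n + 1)
    have h3 := two_mul_natCast_add_two_ne_zero n
    have h4 := two_mul_natCast_add_two_ne_zero (n + 1)
    have h5 : 2 * (s + 1) + 2 * n + 2 ≠ 0 := by convert h1 using 1; push_cast; ring
    push_cast at *
    rw [mul_zero, add_zero] at h0
    field_simp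
    ring

theorem oneTerm_succ_shift_eq_shift {s : ℂ} (hs : ∀ j : ℕ, 2 * s + 2 * j + 2 ≠ 0) (n : ℕ) :
    (2 * s + 3) * oneTerm (s + 2) (n + 1) =
      -(2 * s + 4) * (2 * s + 2 * n + 3) * (2 * s + 2 * n + 5) * (2 * n + 1) /
        ((2 * s + 2 * n + 4) * (2 * s + 2 * n + 6) * (2 * n + 2)) * oneTerm (s + 1) n := by
  have H (n : ℕ) : 2 * s + 2 * n + 4 ≠ 0 := by convert hs (n + 1) using 1; push_cast; ring
  have H' (n : ℕ) : 2 * s + 2 * n + 6 ≠ 0 := by convert hs (n + 2) using 1; push_cast; ring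
  induction n with
  | zero =>
    have h1 := H 0
    have h2 := H' 0
    have e0 : 2 * (s + 2) + 2 = 2 * s + 6 := by ring
    have e1 : 2 * (s + 2) + 1 = 2 * s + 5 := by ring
    simp [oneTerm, e0, e1]
    norm_num at h1 h2
    field_simp
    ring
  | succ n ih =>
    rw [oneTerm_succ, ← mul_assoc, ih, oneTerm_succ]
    have h1 := H n
    have h2 := H' n
    have h3 := H' (n + 1)
    have h4 := two_mul_natCast_add_two_ne_zero n
    have h5 := two_mul_natCast_add_two_ne_zero (n + 1)
    have h6 : 2 * (s + 1) + 2 * n + 2 ≠ 0 := by convert h1 using 1; ring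
    have h7 : 2 * (s + 2) + 2 * (n + 1) + 2 ≠ 0 := by convert h3 using 1; push_cast; ring
    have h8 : 2 * s + 2 * (n + 1) + 4 ≠ 0 := by convert h2 using 1; ring
    push_cast at *
    clear ih
    field_simp
    ring

/-- The limit `q → 1` of `qTerm_sum_telescope`, with `x = q^{2s}`: the contiguous relation behind
Kummer's evaluation at `-1`. -/
theorem oneTerm_sum_telescope {s : ℂ} (hs : ∀ j : ℕ, 2 * s + 2 * j + 2 ≠ 0) (N : ℕ) :
    (2 * s + 2) * (2 * s + 4) * ∑ n ∈ Finset.range (N + 1), oneTerm s n -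
        (2 * s + 3) ^ 2 * ∑ n ∈ Finset.range (N + 1), oneTerm (s + 2) n =
      -(2 * s + 4) * (2 * N + 1) / (2 * s + 2 * N + 4) * oneTerm (s + 1) N := by
  have H (n : ℕ) : 2 * s + 2 * n + 4 ≠ 0 := by convert hs (n + 1) using 1; push_cast; ring
  induction N with
  | zero =>
    have h1 := H 0
    norm_num at h1
    simp [oneTerm]
    field_simp
    ring
  | succ N ih =>
    rw [Finset.sum_range_succ, Finset.sum_range_succ _ (N + 1), mul_add ((2 * s + 2) * (2 * s + 4)),
      mul_add ((2 * s + 3) ^ 2), pow_two (2 * s + 3), mul_assoc _ _ (oneTerm (s + 2) (N + 1)),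
      oneTerm_succ_shift_eq_shift hs, add_sub_add_comm, ← pow_two, ih, oneTerm_succ_eq_shift hs,
      oneTerm_succ]
    have h0 := hs 0
    have h1 := H N
    have h2 := H (N + 1)
    have h3 := two_mul_natCast_add_two_ne_zero N
    have h6 : 2 * s + 2 * N + 6 ≠ 0 := by convert h2 using 1; push_cast; ring
    have e0 : 2 * (s + 1) + 2 * (N : ℂ) + 2 = 2 * s + 2 * N + 4 := by ring
    have e1 : 2 * s + 2 * ((N + 1 : ℕ) : ℂ) + 4 = 2 * s + 2 * N + 6 := by push_cast; ring
    rw [Nat.cast_zero, mul_zero, add_zero] at h0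
    rw [e0, e1]
    push_cast
    clear ih
    generalize oneTerm (s + 1) N = T
    generalize hd1 : 2 * s + 2 * N + 4 = d1 at h1 ⊢
    generalize hd2 : 2 * s + 2 * N + 6 = d2 at h6 ⊢
    generalize hd3 : 2 * (N : ℂ) + 2 = d3 at h3 ⊢
    generalize 2 * s + 2 = d4 at h0 ⊢
    field_simp
    rw [← hd1, ← hd2, ← hd3]
    ring

/-! ### Iterating the recurrence -/

/-- If the sequences `S k` satisfy `S k = ρ k * S (k + 1) + o(1)` and if `S k` converges for all
large `k`, then `S 0` converges, to the infinite product of the `ρ k` times the limit of the limits.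
Only the convergence of the later sequences is assumed, so that convergence is also carried back
to `k = 0`. -/
theorem tendsto_of_iterated_recurrence {S : ℕ → ℕ → ℂ} {ρ F : ℕ → ℂ} {P L : ℂ} (K : ℕ)
    (hS : ∀ k, Tendsto (fun N => S k N - ρ k * S (k + 1) N) atTop (𝓝 0))
    (hSF : ∀ k, K ≤ k → Tendsto (S k) atTop (𝓝 (F k)))
    (hF : Tendsto F atTop (𝓝 L))
    (hP : Tendsto (fun m => ∏ k ∈ Finset.range m, ρ k) atTop (𝓝 P)) :
    Tendsto (S 0) atTop (𝓝 (P * L)) := by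
  have step (m : ℕ) :
      Tendsto (fun N => S 0 N - (∏ k ∈ Finset.range m, ρ k) * S m N) atTop (𝓝 0) := by
    induction m with
    | zero => simp
    | succ m ih =>
      have := ih.add ((hS m).const_mul (∏ k ∈ Finset.range m, ρ k))
      rw [mul_zero, add_zero] at this
      refine this.congr fun N => ?_
      rw [Finset.prod_range_succ]
      ring
  have lim (m : ℕ) (hm : K ≤ m) :
      Tendsto (S 0) atTop (𝓝 ((∏ k ∈ Finset.range m, ρ k) * F m)) := by
    have := (step m).add ((hSF m hm).const_mul (∏ k ∈ Finset.range m, ρ k))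
    rw [zero_add] at this
    exact this.congr fun N => by ring
  have hconst : Tendsto (fun m => (∏ k ∈ Finset.range m, ρ k) * F m) atTop
      (𝓝 ((∏ k ∈ Finset.range K, ρ k) * F K)) :=
    tendsto_const_nhds.congr' <| eventually_atTop.mpr
      ⟨K, fun m hm => tendsto_nhds_unique (lim K le_rfl) (lim m hm)⟩
  rw [tendsto_nhds_unique (hP.mul hF) hconst]
  exact lim K le_rfl

/-! ### The product evaluation for `‖q‖ < 1` -/

theorem tendsto_one_sub_pow_mul {q : ℂ} (hq : ‖q‖ < 1) (x : ℂ) (m : ℕ) :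
    Tendsto (fun n : ℕ => 1 - q ^ (2 * n + m) * x) atTop (𝓝 1) := by
  have h : Tendsto (fun n : ℕ => q ^ (2 * n + m)) atTop (𝓝 0) := by
    refine (tendsto_pow_atTop_nhds_zero_of_norm_lt_one hq).comp (tendsto_atTop_mono
      (fun n => ?_) tendsto_id)
    simp only [id]
    omega
  simpa using (h.mul_const x).const_sub 1

theorem tendsto_one_sub_pow_ratio {q : ℂ} (hq : ‖q‖ < 1) :
    Tendsto (fun n : ℕ => (1 - q ^ (2 * n + 1)) / (1 - q ^ (2 * n + 2))) atTop (𝓝 1) := by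
  simpa [Pi.div_def] using (tendsto_one_sub_pow_mul hq 1 1).div
    (tendsto_one_sub_pow_mul hq 1 2) one_ne_zero

theorem summable_of_tendsto_norm_ratio {u a : ℕ → ℂ} {l : ℂ} (hl : ‖l‖ < 1)
    (hu : ∀ n, u (n + 1) = u n * a n) (ha : Tendsto a atTop (𝓝 l)) : Summable u := by
  obtain ⟨r, hr, hr1⟩ := exists_between hl
  refine summable_of_ratio_norm_eventually_le hr1 ?_
  filter_upwards [ha.norm.eventually (ge_mem_nhds hr)] with n hn
  rw [hu, norm_mul, mul_comm]
  exact mul_le_mul_of_nonneg_right hn (norm_nonneg _)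

theorem summable_qTerm {q : ℂ} (hq : ‖q‖ < 1) (x : ℂ) : Summable (qTerm q x) := by
  refine summable_of_tendsto_norm_ratio (l := -q) (by rwa [norm_neg]) (qTerm_succ q x) ?_
  simpa [Pi.div_def] using (((tendsto_one_sub_pow_mul hq x 1).div (tendsto_one_sub_pow_mul hq x 2)
    one_ne_zero).mul (tendsto_one_sub_pow_ratio hq)).const_mul (-q)

theorem norm_one_sub_div_one_sub_le {u v x : ℂ} {ε : ℝ} (hu : ‖u‖ ≤ 1) (hv : ‖v‖ ≤ 1)
    (hx : ‖x‖ ≤ ε) (hε : ε < 1) : ‖(1 - u * x) / (1 - v * x)‖ ≤ (1 + ε) / (1 - ε) := by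
  have key (w : ℂ) (hw : ‖w‖ ≤ 1) : ‖w * x‖ ≤ ε := by
    rw [norm_mul]
    calc ‖w‖ * ‖x‖ ≤ 1 * ‖x‖ := by gcongr
      _ ≤ ε := by rwa [one_mul]
  rw [norm_div]
  have h1 : ‖1 - u * x‖ ≤ 1 + ε := by
    refine (norm_sub_le _ _).trans ?_
    rw [norm_one]
    linarith [key u hu]
  have h2 : 1 - ε ≤ ‖1 - v * x‖ := by
    have := norm_sub_norm_le (1 : ℂ) (v * x)
    rw [norm_one] at this
    linarith [key v hv]
  have : 0 ≤ ε := (norm_nonneg x).trans hx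
  gcongr

/-- Near `x = 0` the terms have a common summable majorant: for `‖x‖ ≤ ε` each quotient
`(1 - u x) / (1 - v x)` is at most `(1 + ε) / (1 - ε)`, and `ε` is chosen so small that this does
not spoil the geometric factor `‖q‖ < 1`. -/
theorem exists_summable_bound_qTerm {q : ℂ} (hq : ‖q‖ < 1) :
    ∃ ε > 0, ∃ B : ℕ → ℝ, Summable B ∧ ∀ x : ℂ, ‖x‖ ≤ ε → ∀ n, ‖qTerm q x n‖ ≤ B n := by
  set ε : ℝ := (1 - ‖q‖) / 4 with hε
  have hq0 := norm_nonneg q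
  have hε1 : ε < 1 := by linarith
  have hρ : ‖((‖q‖ * ((1 + ε) / (1 - ε)) : ℝ) : ℂ)‖ < 1 := by
    have h0 : 0 ≤ ‖q‖ * ((1 + ε) / (1 - ε)) :=
      mul_nonneg hq0 (div_nonneg (by linarith) (by linarith))
    rw [Complex.norm_real, Real.norm_of_nonneg h0, ← mul_div_assoc, div_lt_one (by linarith)]
    nlinarith
  let C : ℕ → ℂ := fun n => ∏ j ∈ Finset.range n, (((‖q‖ * ((1 + ε) / (1 - ε)) : ℝ) : ℂ) *
    ((1 - q ^ (2 * j + 1)) / (1 - q ^ (2 * j + 2))))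
  have hC : Summable C := by
    refine summable_of_tendsto_norm_ratio hρ (fun n => Finset.prod_range_succ _ _) ?_
    simpa using (tendsto_one_sub_pow_ratio hq).const_mul
      ((‖q‖ * ((1 + ε) / (1 - ε)) : ℝ) : ℂ)
  refine ⟨ε, by linarith, fun n => ‖C n‖, hC.norm, fun x hx n => ?_⟩
  induction n with
  | zero => simp [qTerm, C]
  | succ n ih =>
    have h0 : 0 ≤ ‖q‖ * ((1 + ε) / (1 - ε)) :=
      mul_nonneg hq0 (div_nonneg (by linarith) (by linarith))
    have e : C (n + 1) = C n * (((‖q‖ * ((1 + ε) / (1 - ε)) : ℝ) : ℂ) *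
        ((1 - q ^ (2 * n + 1)) / (1 - q ^ (2 * n + 2)))) := Finset.prod_range_succ _ _
    simp only [e, qTerm_succ, norm_mul, norm_neg, Complex.norm_real ((‖q‖ * ((1 + ε) / (1 - ε)))),
      Real.norm_of_nonneg h0]
    rw [mul_assoc ‖q‖]
    gcongr
    exact norm_one_sub_div_one_sub_le (by rw [norm_pow]; exact pow_le_one₀ hq0 hq.le)
      (by rw [norm_pow]; exact pow_le_one₀ hq0 hq.le) hx hε1

theorem tendsto_tsum_qTerm_zero {q : ℂ} (hq : ‖q‖ < 1) :
    Tendsto (fun x => ∑' n, qTerm q x n) (𝓝 0) (𝓝 (∑' n, qTerm q 0 n)) := by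
  obtain ⟨ε, hε, B, hB, hbound⟩ := exists_summable_bound_qTerm hq
  refine tendsto_tsum_of_dominated_convergence hB (fun n => ?_) ?_
  · have : ContinuousAt (fun x => qTerm q x n) 0 := by
      unfold qTerm
      refine continuousAt_const.mul (tendsto_finsetProd _ fun j _ => ?_)
      refine ContinuousAt.mul (ContinuousAt.div (by fun_prop) (by fun_prop) (by simp))
        continuousAt_const
    exact this
  · filter_upwards [Metric.closedBall_mem_nhds (0 : ℂ) hε] with x hx n
    exact hbound x (by simpa using hx) n

/-- The product evaluation for `‖q‖ < 1`, obtained by iterating the recurrence under `x ↦ q⁴x`,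
since `q^{4k} x → 0`. -/
theorem qTerm_sum_eq {q x P : ℂ} (hq : ‖q‖ < 1)
    (hx : ∀ j : ℕ, 1 - q ^ (2 * j + 2) * x ≠ 0)
    (hP : Tendsto (fun m => ∏ k ∈ Finset.range m, (1 - q ^ (4 * k + 3) * x) ^ 2 /
      ((1 - q ^ (4 * k + 2) * x) * (1 - q ^ (4 * k + 4) * x))) atTop (𝓝 P)) :
    ∑' n, qTerm q x n = P * ∑' n, qTerm q 0 n := by
  have hlim (y : ℂ) : Tendsto (fun N => ∑ n ∈ Finset.range (N + 1), qTerm q y n) atTop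
      (𝓝 (∑' n, qTerm q y n)) :=
    (tendsto_add_atTop_iff_nat 1).mpr (summable_qTerm hq y).hasSum.tendsto_sum_nat
  have main := tendsto_of_iterated_recurrence
    (S := fun k N => ∑ n ∈ Finset.range (N + 1), qTerm q (q ^ (4 * k) * x) n)
    (F := fun k => ∑' n, qTerm q (q ^ (4 * k) * x) n) (L := ∑' n, qTerm q 0 n) 0
    (fun k => ?_) (fun k _ => hlim _) ?_ hP
  · refine tendsto_nhds_unique (hlim x) (main.congr fun N => ?_)
    simp
  · have hy (j : ℕ) : 1 - q ^ (2 * j + 2) * (q ^ (4 * k) * x) ≠ 0 := by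
      convert hx (j + 2 * k) using 2
      ring
    set y := q ^ (4 * k) * x with hyk
    have e3 : q ^ (4 * k + 3) * x = q ^ 3 * y := by rw [hyk]; ring
    have e2 : q ^ (4 * k + 2) * x = q ^ 2 * y := by rw [hyk]; ring
    have e4 : q ^ (4 * k + 4) * x = q ^ 4 * y := by rw [hyk]; ring
    have e4' : q ^ (4 * (k + 1)) * x = q ^ 4 * y := by rw [hyk]; ring
    have h2 : 1 - q ^ 2 * y ≠ 0 := by simpa using hy 0
    have h4 : 1 - q ^ 4 * y ≠ 0 := by simpa using hy 1
    have err : Tendsto (fun N => ((-q ^ 2 * y * (1 - q) * (1 - q ^ 4 * y)) *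
        (1 - q ^ (2 * N + 1) * 1) / (1 - q ^ (2 * N + 4) * y) *
        qTerm q (q ^ 2 * y) N) / ((1 - q ^ 2 * y) * (1 - q ^ 4 * y))) atTop (𝓝 0) := by
      have := ((((tendsto_one_sub_pow_mul hq 1 1).const_mul
        (-q ^ 2 * y * (1 - q) * (1 - q ^ 4 * y))).div (tendsto_one_sub_pow_mul hq y 4)
        one_ne_zero).mul (summable_qTerm hq (q ^ 2 * y)).tendsto_atTop_zero).div_const
        ((1 - q ^ 2 * y) * (1 - q ^ 4 * y))
      simpa only [mul_zero, zero_div, Pi.div_apply] using this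
    refine err.congr fun N => ?_
    rw [mul_one, ← qTerm_sum_telescope hq hy N, e2, e3, e4, e4']
    field_simp
  · refine (tendsto_tsum_qTerm_zero hq).comp ?_
    have := (tendsto_pow_atTop_nhds_zero_of_norm_lt_one
      (by rw [norm_pow]; exact pow_lt_one₀ (norm_nonneg _) hq four_ne_zero : ‖q ^ 4‖ < 1)).mul_const x
    simpa only [zero_mul, ← pow_mul] using this

/-! ### The product evaluation at `q = 1` -/

/-- One step of Euler's transformation of an alternating series: it converges when the terms tend to `0` with
summable differences, and its sum is given by an absolutely convergent series. -/
theorem tendsto_alternating_sum {u : ℕ → ℂ} (h0 : Tendsto u atTop (𝓝 0))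
    (hu : Summable fun n => u n - u (n + 1)) :
    Tendsto (fun N => ∑ n ∈ Finset.range N, (-1) ^ n * u n) atTop
      (𝓝 ((u 0 + ∑' n, (-1) ^ n * (u n - u (n + 1))) / 2)) := by
  have hs : Summable fun n => (-1) ^ n * (u n - u (n + 1)) := by
    refine .of_norm ?_
    simpa using hu.norm
  have hz : Tendsto (fun N => (-1) ^ N * u N) atTop (𝓝 0) := by
    rw [tendsto_zero_iff_norm_tendsto_zero] at h0 ⊢
    simpa using h0
  have e (N : ℕ) : ∑ n ∈ Finset.range N, (-1) ^ n * u n =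
      (u 0 + ∑ n ∈ Finset.range N, (-1) ^ n * (u n - u (n + 1)) - (-1) ^ N * u N) / 2 := by
    induction N with
    | zero => simp
    | succ N ih =>
      rw [Finset.sum_range_succ, Finset.sum_range_succ, ih]
      ring
  have := ((hs.hasSum.tendsto_sum_nat.const_add (u 0)).sub hz).div_const 2
  rw [sub_zero] at this
  exact this.congr fun N => (e N).symm

/-- The coefficient `∏_{j=1}^n (2j-1)/(2j) = (2n choose n) / 4^n`. -/
def centralCoeff (n : ℕ) : ℝ := ∏ j ∈ Finset.range n, (2 * (j : ℝ) + 1) / (2 * j + 2)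

theorem centralCoeff_succ (n : ℕ) :
    centralCoeff (n + 1) = centralCoeff n * ((2 * (n : ℝ) + 1) / (2 * n + 2)) :=
  Finset.prod_range_succ _ _

theorem centralCoeff_pos (n : ℕ) : 0 < centralCoeff n :=
  Finset.prod_pos fun j _ => by positivity

/-- This makes `centralCoeff n / (2 * n + 2)` summable by telescoping. -/
theorem centralCoeff_sub_succ (n : ℕ) :
    centralCoeff n - centralCoeff (n + 1) = centralCoeff n / (2 * n + 2) := by
  rw [centralCoeff_succ]
  field_simp
  ring

theorem tendsto_centralCoeff : Tendsto centralCoeff atTop (𝓝 0) := by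
  have hb (n : ℕ) : centralCoeff n ^ 2 ≤ 1 / (2 * n + 1) := by
    induction n with
    | zero => simp [centralCoeff]
    | succ n ih =>
      rw [centralCoeff_succ, mul_pow]
      calc centralCoeff n ^ 2 * ((2 * (n : ℝ) + 1) / (2 * n + 2)) ^ 2
          ≤ 1 / (2 * n + 1) * ((2 * (n : ℝ) + 1) / (2 * n + 2)) ^ 2 := by gcongr
        _ = (2 * (n : ℝ) + 1) / (2 * n + 2) ^ 2 := by
          rw [div_pow]
          field_simp
        _ ≤ 1 / (2 * ((n + 1 : ℕ) : ℝ) + 1) := by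
          rw [div_le_div_iff₀ (by positivity) (by positivity)]
          push_cast
          nlinarith
  have hsq : Tendsto (fun n => centralCoeff n ^ 2) atTop (𝓝 0) := by
    refine squeeze_zero (fun n => sq_nonneg _) hb ?_
    refine squeeze_zero (fun n => by positivity) (fun n => ?_)
      (tendsto_one_div_add_atTop_nhds_zero_nat (𝕜 := ℝ))
    gcongr
    linarith [(Nat.cast_nonneg n : (0 : ℝ) ≤ n)]
  have := hsq.sqrt
  rw [Real.sqrt_zero] at this
  exact this.congr fun n => Real.sqrt_sq (centralCoeff_pos n).le

theorem summable_centralCoeff_sub :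
    Summable fun n => centralCoeff n - centralCoeff (n + 1) := by
  refine summable_of_sum_range_le (c := 1) (fun n => ?_) fun n => ?_
  · rw [centralCoeff_sub_succ]
    have := centralCoeff_pos n
    positivity
  · rw [Finset.sum_range_sub']
    have := centralCoeff_pos n
    simp only [centralCoeff, Finset.range_zero, Finset.prod_empty] at this ⊢
    linarith

/-- The absolute coefficient of the series at `q = 1`: `oneTerm` without its sign. -/
def oneCoeff (s : ℂ) (n : ℕ) : ℂ :=
  ∏ j ∈ Finset.range n,
    (2 * (j : ℂ) + 1) * (2 * s + 2 * j + 1) / ((2 * j + 2) * (2 * s + 2 * j + 2))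

theorem oneTerm_eq (s : ℂ) (n : ℕ) : oneTerm s n = (-1) ^ n * oneCoeff s n := rfl

theorem oneCoeff_succ (s : ℂ) (n : ℕ) :
    oneCoeff s (n + 1) = oneCoeff s n *
      ((2 * (n : ℂ) + 1) * (2 * s + 2 * n + 1) / ((2 * n + 2) * (2 * s + 2 * n + 2))) :=
  Finset.prod_range_succ _ _

theorem norm_le_norm_add_one {z : ℂ} (hz : -1 / 2 ≤ z.re) : ‖z‖ ≤ ‖z + 1‖ := by
  rw [Complex.norm_def, Complex.norm_def]
  apply Real.sqrt_le_sqrt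
  simp only [Complex.normSq_apply, Complex.add_re, Complex.add_im, Complex.one_re, Complex.one_im]
  nlinarith

theorem norm_oneFactor_le {s : ℂ} {n : ℕ} (h : 0 ≤ s.re + n) :
    ‖(2 * (n : ℂ) + 1) * (2 * s + 2 * n + 1) / ((2 * n + 2) * (2 * s + 2 * n + 2))‖ ≤
      (2 * (n : ℝ) + 1) / (2 * n + 2) := by
  have h1 : ‖2 * (n : ℂ) + 1‖ = 2 * n + 1 := by
    exact_mod_cast Complex.norm_natCast (2 * n + 1)
  have h2 : ‖2 * (n : ℂ) + 2‖ = 2 * n + 2 := by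
    exact_mod_cast Complex.norm_natCast (2 * n + 2)
  have h3 : ‖2 * s + 2 * n + 1‖ ≤ ‖2 * s + 2 * n + 2‖ := by
    have e : 2 * s + 2 * (n : ℂ) + 2 = (2 * s + 2 * n + 1) + 1 := by ring
    rw [e]
    apply norm_le_norm_add_one
    simp
    linarith
  rw [mul_div_mul_comm, norm_mul, norm_div, norm_div, h1, h2]
  have h4 : ‖2 * s + 2 * n + 1‖ / ‖2 * s + 2 * n + 2‖ ≤ 1 := div_le_one_of_le₀ h3 (norm_nonneg _)
  exact mul_le_of_le_one_right (by positivity) h4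

theorem norm_oneCoeff_le {s : ℂ} (hs : 0 ≤ s.re) (n : ℕ) : ‖oneCoeff s n‖ ≤ centralCoeff n := by
  rw [oneCoeff, norm_prod]
  exact Finset.prod_le_prod (fun _ _ => norm_nonneg _) fun j _ =>
    norm_oneFactor_le (add_nonneg hs j.cast_nonneg)

theorem tendsto_oneCoeff (s : ℂ) : Tendsto (oneCoeff s) atTop (𝓝 0) := by
  obtain ⟨M, hM⟩ := exists_nat_ge (-s.re)
  have hb (n : ℕ) (hn : M ≤ n) :
      ‖oneCoeff s n‖ ≤ ‖oneCoeff s M‖ / centralCoeff M * centralCoeff n := by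
    induction n, hn using Nat.le_induction with
    | base => rw [div_mul_cancel₀ _ (centralCoeff_pos M).ne']
    | succ n hn ih =>
      rw [oneCoeff_succ, norm_mul, centralCoeff_succ, ← mul_assoc]
      have h : (M : ℝ) ≤ n := by exact_mod_cast hn
      have h0 := centralCoeff_pos M
      have h1 := centralCoeff_pos n
      exact mul_le_mul ih (norm_oneFactor_le (by linarith)) (norm_nonneg _) (by positivity)
  refine squeeze_zero_norm' (eventually_atTop.mpr ⟨M, hb⟩) ?_
  simpa using tendsto_centralCoeff.const_mul (‖oneCoeff s M‖ / centralCoeff M)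

/-- A bound for the differences of the coefficients that is uniform in the half plane `Re s ≥ 0`. -/
theorem norm_oneCoeff_sub_le {s : ℂ} (hs : 0 ≤ s.re) (n : ℕ) :
    ‖oneCoeff s n - oneCoeff s (n + 1)‖ ≤ 2 * (centralCoeff n - centralCoeff (n + 1)) := by
  set w := 2 * s + 2 * (n : ℂ) + 2 with hw
  have hre : 2 * (n : ℝ) + 2 ≤ w.re := by simp [hw]; linarith
  have hwn : 2 * (n : ℝ) + 2 ≤ ‖w‖ := hre.trans (Complex.re_le_norm w)
  have hn : (0 : ℝ) ≤ n := n.cast_nonneg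
  have hw0 : w ≠ 0 := norm_pos_iff.mp (by linarith)
  have h3 := two_mul_natCast_add_two_ne_zero n
  have e : oneCoeff s n - oneCoeff s (n + 1) =
      oneCoeff s n * ((w + (2 * n + 1)) / ((2 * n + 2) * w)) := by
    rw [oneCoeff_succ, ← hw]
    have : 2 * s + 2 * (n : ℂ) + 1 = w - 1 := by rw [hw]; ring
    rw [this]
    field_simp
    ring
  have h1 : ‖2 * (n : ℂ) + 1‖ = 2 * n + 1 := by
    exact_mod_cast Complex.norm_natCast (2 * n + 1)
  have h2 : ‖2 * (n : ℂ) + 2‖ = 2 * n + 2 := by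
    exact_mod_cast Complex.norm_natCast (2 * n + 2)
  have h4 : ‖(w + (2 * n + 1)) / ((2 * n + 2) * w)‖ ≤ 2 / (2 * n + 2) := by
    rw [norm_div, norm_mul, h2, div_le_div_iff₀ (by positivity) (by positivity)]
    have := norm_add_le w (2 * n + 1)
    rw [h1] at this
    nlinarith
  rw [e, norm_mul, centralCoeff_sub_succ]
  calc _ ≤ centralCoeff n * (2 / (2 * n + 2)) := by
        gcongr
        · exact (centralCoeff_pos n).le
        · exact norm_oneCoeff_le hs n
    _ = _ := by ring

theorem tendsto_oneTerm_sum_of_re_nonneg {s : ℂ} (hs : 0 ≤ s.re) :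
    Tendsto (fun N => ∑ n ∈ Finset.range N, oneTerm s n) atTop
      (𝓝 ((1 + ∑' n, (-1) ^ n * (oneCoeff s n - oneCoeff s (n + 1))) / 2)) := by
  have h : Summable fun n => oneCoeff s n - oneCoeff s (n + 1) :=
    .of_norm_bounded (summable_centralCoeff_sub.mul_left 2) (norm_oneCoeff_sub_le hs)
  have := tendsto_alternating_sum (tendsto_oneCoeff s) h
  simpa only [oneTerm_eq, oneCoeff, Finset.range_zero, Finset.prod_empty] using this

theorem tendsto_centralCoeff_sum :
    Tendsto (fun N => ∑ n ∈ Finset.range N, (-1) ^ n * (centralCoeff n : ℂ)) atTop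
      (𝓝 ((1 + ∑' n, (-1) ^ n * ((centralCoeff n : ℂ) - centralCoeff (n + 1))) / 2)) := by
  have h : Summable fun n => (centralCoeff n : ℂ) - centralCoeff (n + 1) := by
    exact_mod_cast Complex.summable_ofReal.mpr summable_centralCoeff_sub
  have h0 : Tendsto (fun n => (centralCoeff n : ℂ)) atTop (𝓝 0) := by
    exact_mod_cast (Complex.continuous_ofReal.tendsto 0).comp tendsto_centralCoeff
  have := tendsto_alternating_sum h0 h
  simpa [centralCoeff] using this

theorem tendsto_oneCoeff_shift (s : ℂ) (n : ℕ) :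
    Tendsto (fun k : ℕ => oneCoeff (s + 2 * k) n) atTop (𝓝 (centralCoeff n)) := by
  have e : (centralCoeff n : ℂ) =
      ∏ j ∈ Finset.range n, (2 * (j : ℂ) + 1) / (2 * j + 2) * (1 - 0) := by
    rw [centralCoeff]
    push_cast
    simp
  rw [e]
  unfold oneCoeff
  refine tendsto_finsetProd _ fun j _ => ?_
  have hcob : Tendsto (fun k : ℕ => 2 * (s + 2 * k) + 2 * (j : ℂ) + 2) atTop
      (Bornology.cobounded ℂ) := by
    rw [← tendsto_norm_atTop_iff_cobounded]
    have : Tendsto (fun k : ℕ => (2 * s + 2 * j + 2).re + 4 * (k : ℝ)) atTop atTop :=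
      tendsto_atTop_add_const_left _ _
        (tendsto_natCast_atTop_atTop.const_mul_atTop (by norm_num))
    refine tendsto_atTop_mono (fun k => ?_) this
    refine le_trans (le_of_eq ?_) (Complex.re_le_norm _)
    simp
    ring
  have hinv := (tendsto_inv₀_cobounded.comp hcob).const_sub 1
  refine (hinv.const_mul ((2 * (j : ℂ) + 1) / (2 * j + 2))).congr' ?_
  filter_upwards [hcob.eventually_ne_cobounded 0] with k hk
  have h3 := two_mul_natCast_add_two_ne_zero j
  have e1 : 2 * (s + 2 * k) + 2 * (j : ℂ) + 1 = (2 * (s + 2 * k) + 2 * (j : ℂ) + 2) - 1 := by ring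
  rw [e1, Function.comp_apply]
  generalize 2 * (s + 2 * k) + 2 * (j : ℂ) + 2 = d at hk ⊢
  field_simp

/-- The product evaluation at `q = 1`, obtained by iterating the recurrence under `s ↦ s + 2`. Along
`s + 2k` the real part is eventually nonnegative, where Euler's transformation applies uniformly. -/
theorem tendsto_oneTerm_sum {s P : ℂ} (hs : ∀ j : ℕ, 2 * s + 2 * j + 2 ≠ 0)
    (hP : Tendsto (fun m => ∏ k ∈ Finset.range m, (2 * s + 4 * k + 3) ^ 2 /
      ((2 * s + 4 * k + 2) * (2 * s + 4 * k + 4))) atTop (𝓝 P)) :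
    Tendsto (fun N => ∑ n ∈ Finset.range N, oneTerm s n) atTop
      (𝓝 (P * ((1 + ∑' n, (-1) ^ n * ((centralCoeff n : ℂ) - centralCoeff (n + 1))) / 2))) := by
  obtain ⟨K, hK⟩ := exists_nat_ge (-s.re)
  have hre (k : ℕ) (hk : K ≤ k) : 0 ≤ (s + 2 * k).re := by
    have : (K : ℝ) ≤ k := by exact_mod_cast hk
    have h0 : (0 : ℝ) ≤ k := k.cast_nonneg
    simp
    linarith
  have main := tendsto_of_iterated_recurrence
    (S := fun k N => ∑ n ∈ Finset.range (N + 1), oneTerm (s + 2 * k) n)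
    (F := fun k => (1 + ∑' n, (-1) ^ n * (oneCoeff (s + 2 * k) n - oneCoeff (s + 2 * k) (n + 1))) / 2)
    (L := (1 + ∑' n, (-1) ^ n * ((centralCoeff n : ℂ) - centralCoeff (n + 1))) / 2) K
    (fun k => ?_) (fun k hk => ?_) ?_ hP
  · rw [← tendsto_add_atTop_iff_nat 1]
    simpa using main
  · have hy (j : ℕ) : 2 * (s + 2 * k) + 2 * j + 2 ≠ 0 := by
      convert hs (j + 2 * k) using 1
      push_cast
      ring
    have e3 : 2 * s + 4 * k + 3 = 2 * (s + 2 * k) + 3 := by ring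
    have e2 : 2 * s + 4 * k + 2 = 2 * (s + 2 * k) + 2 := by ring
    have e4 : 2 * s + 4 * k + 4 = 2 * (s + 2 * k) + 4 := by ring
    have e4' : s + 2 * ((k + 1 : ℕ) : ℂ) = s + 2 * k + 2 := by push_cast; ring
    simp only [e4', e3, e2, e4]
    generalize s + 2 * (k : ℂ) = t at hy
    have h2 : 2 * t + 2 ≠ 0 := by simpa using hy 0
    have h4 : 2 * t + 4 ≠ 0 := by convert hy 1 using 1; push_cast; ring
    -- `(2N+1)/(2t+2N+4) = 1 - (2t+3)/(2t+2N+4)` is bounded in `N`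
    have err : Tendsto (fun N : ℕ => ((-(2 * t + 4)) * (2 * N + 1) / (2 * t + 2 * N + 4) *
        oneTerm (t + 1) N) / ((2 * t + 2) * (2 * t + 4))) atTop (𝓝 0) := by
      have hcob : Tendsto (fun N : ℕ => 2 * t + 2 * (N : ℂ) + 4) atTop
          (Bornology.cobounded ℂ) := by
        rw [← tendsto_norm_atTop_iff_cobounded]
        have : Tendsto (fun k : ℕ => (2 * t + 4).re + 2 * (k : ℝ)) atTop atTop :=
          tendsto_atTop_add_const_left _ _
            (tendsto_natCast_atTop_atTop.const_mul_atTop (by norm_num))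
        refine tendsto_atTop_mono (fun k => ?_) this
        refine le_trans (le_of_eq ?_) (Complex.re_le_norm _)
        simp
        ring
      have hinv := ((tendsto_inv₀_cobounded.comp hcob).const_mul (2 * t + 3)).const_sub 1
      have hz : Tendsto (oneTerm (t + 1)) atTop (𝓝 0) := by
        rw [tendsto_zero_iff_norm_tendsto_zero]
        simpa [oneTerm_eq] using (tendsto_oneCoeff (t + 1)).norm
      have := ((hinv.mul hz).const_mul (-(2 * t + 4))).div_const ((2 * t + 2) * (2 * t + 4))
      rw [mul_zero, mul_zero, zero_div] at this
      refine this.congr fun N => ?_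
      have h5 : 2 * t + 2 * (N : ℂ) + 4 ≠ 0 := by convert hy (N + 1) using 1; push_cast; ring
      rw [Function.comp_apply]
      generalize hd : 2 * t + 2 * (N : ℂ) + 4 = d at h5 ⊢
      have : 2 * (N : ℂ) + 1 = d - (2 * t + 3) := by rw [← hd]; ring
      rw [this]
      field_simp
    refine err.congr fun N => ?_
    rw [← oneTerm_sum_telescope hy N]
    generalize 2 * t + 2 = a at h2 ⊢
    generalize 2 * t + 4 = b at h4 ⊢
    field_simp
  · exact (tendsto_add_atTop_iff_nat 1).mpr (tendsto_oneTerm_sum_of_re_nonneg (hre k hk))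
  · refine ((tendsto_tsum_of_dominated_convergence (summable_centralCoeff_sub.mul_left 2)
      (fun n => ((tendsto_oneCoeff_shift s n).sub (tendsto_oneCoeff_shift s (n + 1))).const_mul
        ((-1) ^ n)) ?_).const_add 1).div_const 2
    filter_upwards [eventually_ge_atTop K] with k hk n
    rw [norm_mul, norm_pow, norm_neg, norm_one, one_pow, one_mul]
    exact norm_oneCoeff_sub_le (hre k hk) n

/-! ### Gamma values at `q = 1` -/

/-- An infinite product of quotients as a quotient of Gamma values; if `c` is a pole of `Γ`, both
the product and (by `1 / 0 = 0`) the quotient vanish. -/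
theorem tendsto_prod_gammaRatio {a b c : ℂ} (h : a + b = 2 * c) (ha : ∀ m : ℕ, a ≠ -m)
    (hb : ∀ m : ℕ, b ≠ -m) :
    Tendsto (fun N => ∏ n ∈ Finset.range N, (c + n) ^ 2 / ((a + n) * (b + n))) atTop
      (𝓝 (Complex.Gamma a * Complex.Gamma b / Complex.Gamma c ^ 2)) := by
  by_cases hc : ∃ m : ℕ, c = -m
  · obtain ⟨m, hm⟩ := hc
    rw [(Complex.Gamma_eq_zero_iff c).mpr ⟨m, hm⟩, zero_pow two_ne_zero, div_zero]
    refine tendsto_const_nhds.congr' (eventually_atTop.mpr ⟨m + 1, fun N hN => ?_⟩)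
    refine (Finset.prod_eq_zero (Finset.mem_range.mpr (show m < N by omega)) ?_).symm
    rw [hm]
    simp
  push Not at hc
  rw [← tendsto_add_atTop_iff_nat 1]
  have hlim := ((Complex.GammaSeq_tendsto_Gamma a).mul (Complex.GammaSeq_tendsto_Gamma b)).div
    ((Complex.GammaSeq_tendsto_Gamma c).pow 2) (pow_ne_zero 2 (Complex.Gamma_ne_zero hc))
  refine hlim.congr' (eventually_atTop.mpr ⟨1, fun N hN => ?_⟩)
  have hN0 : (N : ℂ) ≠ 0 := by exact_mod_cast (by omega : N ≠ 0)
  have hf : (N.factorial : ℂ) ≠ 0 := by exact_mod_cast N.factorial_ne_zero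
  have hp (z : ℂ) (hz : ∀ m : ℕ, z ≠ -m) : ∏ j ∈ Finset.range (N + 1), (z + j) ≠ 0 :=
    Finset.prod_ne_zero_iff.mpr fun j _ h0 => hz j (eq_neg_of_add_eq_zero_left h0)
  have hpa := hp a ha
  have hpb := hp b hb
  have hpc := hp c hc
  have hpow : (N : ℂ) ^ a * (N : ℂ) ^ b = ((N : ℂ) ^ c) ^ 2 := by
    rw [← Complex.cpow_add _ _ hN0, h, two_mul, Complex.cpow_add _ _ hN0, sq]
  have hNc : (N : ℂ) ^ c ≠ 0 := by simp [Complex.cpow_eq_zero_iff, hN0]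
  simp only [Pi.div_apply, Complex.GammaSeq]
  rw [Finset.prod_div_distrib, Finset.prod_pow, Finset.prod_mul_distrib]
  generalize ∏ j ∈ Finset.range (N + 1), (a + j) = pa at *
  generalize ∏ j ∈ Finset.range (N + 1), (b + j) = pb at *
  generalize ∏ j ∈ Finset.range (N + 1), (c + j) = pc at *
  rw [div_mul_div_comm, mul_mul_mul_comm, hpow]
  field_simp

theorem ne_neg_natCast_of_ne {s : ℂ} (hs : ∀ j : ℕ, s ≠ -((j : ℂ) + 1)) (m : ℕ) :
    s / 2 + 1 / 2 ≠ -m ∧ s / 2 + 1 ≠ -m := by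
  refine ⟨fun h => hs (2 * m) ?_, fun h => hs (2 * m + 1) ?_⟩
  · push_cast
    linear_combination 2 * h
  · push_cast
    linear_combination 2 * h

/-- The value of `∏ (2s+4n+3)² / ((2s+4n+2) (2s+4n+4))` in terms of the Gamma function. -/
def gammaProd (s : ℂ) : ℂ :=
  Complex.Gamma (s / 2 + 1 / 2) * Complex.Gamma (s / 2 + 1) / Complex.Gamma (s / 2 + 3 / 4) ^ 2

theorem tendsto_prod_gammaProd {s : ℂ} (hs : ∀ j : ℕ, s ≠ -((j : ℂ) + 1)) :
    Tendsto (fun m => ∏ k ∈ Finset.range m, (2 * s + 4 * k + 3) ^ 2 /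
      ((2 * s + 4 * k + 2) * (2 * s + 4 * k + 4))) atTop (𝓝 (gammaProd s)) := by
  refine (tendsto_prod_gammaRatio (by ring) (fun m => (ne_neg_natCast_of_ne hs m).1)
    (fun m => (ne_neg_natCast_of_ne hs m).2)).congr fun m => Finset.prod_congr rfl fun k _ => ?_
  have e1 : 2 * s + 4 * k + 3 = 4 * (s / 2 + 3 / 4 + k) := by ring
  have e2 : 2 * s + 4 * k + 2 = 4 * (s / 2 + 1 / 2 + k) := by ring
  have e3 : 2 * s + 4 * k + 4 = 4 * (s / 2 + 1 + k) := by ring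
  rw [e1, e2, e3, mul_pow, mul_mul_mul_comm, ← pow_two 4, mul_div_mul_left _ _ (by norm_num)]

/-- A case of the reflection formula, as `Γ(1/4) Γ(3/4) = π √2`. -/
theorem gammaProd_neg_half : gammaProd (-1 / 2) = Real.sqrt 2 := by
  have h := Complex.Gamma_mul_Gamma_one_sub (1 / 4)
  have hs : Complex.sin (Real.pi * (1 / 4)) = (Real.sqrt 2 / 2 : ℝ) := by
    rw [← Real.sin_pi_div_four]
    push_cast
    congr 1
    ring
  have hpi : (Real.pi : ℂ) ≠ 0 := by exact_mod_cast Real.pi_ne_zero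
  have h2 : (Real.sqrt 2 : ℂ) ≠ 0 := by simp
  have h2' : (Real.sqrt 2 : ℂ) ^ 2 = 2 := by exact_mod_cast Real.sq_sqrt (zero_le_two (α := ℝ))
  have hg : Complex.Gamma (1 / 2) ^ 2 = Real.pi := by
    have := Complex.Gamma_mul_Gamma_one_sub (1 / 2)
    rw [show (1 : ℂ) - 1 / 2 = 1 / 2 by norm_num, mul_one_div, Complex.sin_pi_div_two, div_one]
      at this
    rw [sq, this]
  rw [hs, show (1 : ℂ) - 1 / 4 = 3 / 4 by norm_num] at h
  rw [gammaProd, show (-1 / 2 / 2 + 1 / 2 : ℂ) = 1 / 4 by norm_num,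
    show (-1 / 2 / 2 + 1 : ℂ) = 3 / 4 by norm_num, show (-1 / 2 / 2 + 3 / 4 : ℂ) = 1 / 2 by norm_num,
    hg, h]
  push_cast
  field_simp
  exact h2'.symm

theorem two_mul_add_ne_zero_of_ne {s : ℂ} (hs : ∀ j : ℕ, s ≠ -((j : ℂ) + 1)) (j : ℕ) :
    2 * s + 2 * j + 2 ≠ 0 :=
  fun h => hs j (by linear_combination h / 2)

/-- The value `1/√2` of the series `f(0,1)`. It is read off from the product evaluation at
`s = -1/2`, where the series on the left reduces to its first term `1`. -/
theorem centralCoeff_sum_eq :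
    (1 + ∑' n, (-1) ^ n * ((centralCoeff n : ℂ) - centralCoeff (n + 1))) / 2 =
      1 / (Real.sqrt 2 : ℂ) := by
  have hs (j : ℕ) : (-1 / 2 : ℂ) ≠ -((j : ℂ) + 1) := by
    intro h
    have h' := congrArg Complex.re h
    simp at h'
    have : (0 : ℝ) ≤ j := j.cast_nonneg
    linarith
  have h := tendsto_oneTerm_sum (two_mul_add_ne_zero_of_ne hs) (tendsto_prod_gammaProd hs)
  rw [gammaProd_neg_half] at h
  have h1 : Tendsto (fun N => ∑ n ∈ Finset.range N, oneTerm (-1 / 2) n) atTop (𝓝 1) := by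
    refine tendsto_const_nhds.congr' (eventually_atTop.mpr ⟨1, fun N hN => ?_⟩)
    beta_reduce
    rw [Finset.sum_eq_single_of_mem 0 (Finset.mem_range.mpr hN), oneTerm_zero]
    intro n _ hn
    rw [oneTerm, Finset.prod_eq_zero (Finset.mem_range.mpr (Nat.pos_of_ne_zero hn)), mul_zero]
    norm_num
  have h2 : (Real.sqrt 2 : ℂ) ≠ 0 := by simp
  rw [eq_div_iff h2, mul_comm]
  exact tendsto_nhds_unique h h1

/-- Kummer's evaluation, with the value of `f(0,1)` inserted. -/
theorem tendsto_oneTerm_sum_gamma {s : ℂ} (hs : ∀ j : ℕ, s ≠ -((j : ℂ) + 1)) :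
    Tendsto (fun N => ∑ n ∈ Finset.range N, oneTerm s n) atTop
      (𝓝 (1 / (Real.sqrt 2 : ℂ) * gammaProd s)) := by
  rw [← centralCoeff_sum_eq, mul_comm]
  exact tendsto_oneTerm_sum (two_mul_add_ne_zero_of_ne hs) (tendsto_prod_gammaProd hs)

theorem Gamma_half_add_half_mul_Gamma_half_add_one (s : ℂ) :
    Complex.Gamma (s / 2 + 1 / 2) * Complex.Gamma (s / 2 + 1) =
      Real.sqrt Real.pi / 2 ^ s * Complex.Gamma (s + 1) := by
  have h := Complex.Gamma_mul_Gamma_add_half (s / 2 + 1 / 2)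
  rw [show s / 2 + 1 / 2 + 1 / 2 = s / 2 + 1 by ring, show 2 * (s / 2 + 1 / 2) = s + 1 by ring,
    show 1 - (s + 1) = -s by ring, Complex.cpow_neg] at h
  rw [h]
  ring

/-- The Gamma quotient in the form of the second evaluation at `q = 1`, by the duplication formula. -/
theorem gammaProd_eq (s : ℂ) : gammaProd s =
    Real.sqrt Real.pi / 2 ^ s * (Complex.Gamma (s + 1) / Complex.Gamma ((2 * s - 1) / 4 + 1) ^ 2) := by
  rw [gammaProd, Gamma_half_add_half_mul_Gamma_half_add_one,
    show (2 * s - 1) / 4 + 1 = s / 2 + 3 / 4 by ring, mul_div_assoc]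

/-! ### Infinite `q`-Pochhammer symbols -/

/-- The infinite `q`-Pochhammer symbol `(y; p)_∞ = ∏_{n ≥ 0} (1 - y p^n)`. -/
def qPoch (y p : ℂ) : ℂ := ∏' n : ℕ, (1 - y * p ^ n)

theorem summable_norm_neg_mul_pow {p : ℂ} (hp : ‖p‖ < 1) (y : ℂ) :
    Summable fun n : ℕ => ‖-(y * p ^ n)‖ := by
  simpa using (summable_geometric_of_lt_one (norm_nonneg p) hp).mul_left ‖y‖

theorem multipliable_one_sub_mul_pow {p : ℂ} (hp : ‖p‖ < 1) (y : ℂ) :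
    Multipliable fun n : ℕ => 1 - y * p ^ n := by
  simpa only [sub_eq_add_neg] using
    multipliable_one_add_of_summable (summable_norm_neg_mul_pow hp y)

theorem qPoch_ne_zero {y p : ℂ} (hp : ‖p‖ < 1) (hy : ∀ n : ℕ, 1 - y * p ^ n ≠ 0) :
    qPoch y p ≠ 0 := by
  have := tprod_one_add_ne_zero_of_summable (f := fun n : ℕ => -(y * p ^ n))
    (by simpa only [← sub_eq_add_neg] using hy) (summable_norm_neg_mul_pow hp y)
  simpa only [qPoch, sub_eq_add_neg] using this

theorem qPoch_eq_mul {p : ℂ} (hp : ‖p‖ < 1) (y : ℂ) :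
    qPoch y p = qPoch y (p ^ 2) * qPoch (y * p) (p ^ 2) := by
  have hp2 : ‖p ^ 2‖ < 1 := by
    rw [norm_pow]
    exact pow_lt_one₀ (norm_nonneg _) hp two_ne_zero
  have e1 (n : ℕ) : 1 - y * (p ^ 2) ^ n = 1 - y * p ^ (2 * n) := by rw [pow_mul]
  have e2 (n : ℕ) : 1 - y * p * (p ^ 2) ^ n = 1 - y * p ^ (2 * n + 1) := by
    rw [← pow_mul]
    ring
  have h1 := multipliable_one_sub_mul_pow hp2 y
  have h2 := multipliable_one_sub_mul_pow hp2 (y * p)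
  simp only [e1] at h1
  simp only [e2] at h2
  simp only [qPoch, e1, e2]
  exact (tprod_even_mul_odd (f := fun n => 1 - y * p ^ n) h1 h2).symm

theorem hasProd_qPoch_div {p b : ℂ} (hp : ‖p‖ < 1) (a : ℂ) (hb : ∀ n : ℕ, 1 - b * p ^ n ≠ 0) :
    HasProd (fun n : ℕ => (1 - a * p ^ n) / (1 - b * p ^ n)) (qPoch a p / qPoch b p) :=
  (multipliable_one_sub_mul_pow hp a).hasProd.div₀ (multipliable_one_sub_mul_pow hp b).hasProd
    (qPoch_ne_zero hp hb)

/-- If some denominator vanishes, then both sides are `0`, since division by `0` gives `0`; this is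
what makes `1 / (α)!_q` vanish at the poles. -/
theorem tprod_qPoch_div {p : ℂ} (hp : ‖p‖ < 1) (a b : ℂ) :
    ∏' n : ℕ, (1 - a * p ^ n) / (1 - b * p ^ n) = qPoch a p / qPoch b p := by
  by_cases hb : ∃ n : ℕ, 1 - b * p ^ n = 0
  · have h : qPoch b p = 0 := tprod_of_exists_eq_zero hb
    obtain ⟨n, hn⟩ := hb
    rw [h, div_zero]
    exact tprod_of_exists_eq_zero ⟨n, by rw [hn, div_zero]⟩
  · push Not at hb
    exact (hasProd_qPoch_div hp a hb).tprod_eq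

/-! ### The constant `C₃(q)` -/

theorem one_sub_pow_pos {q : ℝ} (h0 : 0 < q) (h1 : q < 1) (m : ℕ) (hm : m ≠ 0) : 0 < 1 - q ^ m :=
  sub_pos.mpr (pow_lt_one₀ h0.le h1 hm)

theorem norm_ofReal_lt_one {q : ℝ} (h0 : 0 < q) (h1 : q < 1) : ‖(q : ℂ)‖ < 1 := by
  rwa [Complex.norm_real, Real.norm_of_nonneg h0.le]

theorem norm_ofReal_pow_lt_one {q : ℝ} (h0 : 0 < q) (h1 : q < 1) (m : ℕ) (hm : m ≠ 0) :
    ‖(q : ℂ) ^ m‖ < 1 := by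
  rw [norm_pow]
  exact pow_lt_one₀ (norm_nonneg _) (norm_ofReal_lt_one h0 h1) hm

/-- Divided by `1 - v`, this says that the `2n+1` terms of `1 + v + ⋯ + v^{2n}` have mean at least
their geometric mean `v^n`. -/
theorem mul_pow_mul_one_sub_le {v : ℝ} (hv : 0 ≤ v) (hv1 : v ≤ 1) (n : ℕ) :
    (2 * n + 1) * v ^ n * (1 - v) ≤ 1 - v ^ (2 * n + 1) := by
  induction n with
  | zero => simp
  | succ n ih =>
    have b1 := one_add_mul_le_pow (a := v - 1) (by linarith) (n + 1)
    have b2 := one_add_mul_le_pow (a := v - 1) (by linarith) (n + 2)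
    rw [add_sub_cancel] at b1 b2
    push_cast at b1 b2
    have hb : 0 ≤ v ^ (n + 2) + v ^ (n + 1) - (2 * n + 3) * v + (2 * n + 1) := by linarith
    have h := mul_nonneg (mul_nonneg (sub_nonneg.mpr hv1) (pow_nonneg hv n)) hb
    have e : (1 - v) * v ^ n * (v ^ (n + 2) + v ^ (n + 1) - (2 * n + 3) * v + (2 * n + 1)) =
        (1 - v ^ (2 * (n + 1) + 1) - (2 * ((n + 1 : ℕ) : ℝ) + 1) * v ^ (n + 1) * (1 - v)) -
          (1 - v ^ (2 * n + 1) - (2 * n + 1) * v ^ n * (1 - v)) := by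
      push_cast
      ring
    linarith

theorem C₃Factor_one (n : ℕ) : C₃Factor 1 n = 1 + 1 / ((2 * n + 1) * (2 * n + 3)) := by
  rw [C₃Factor, if_pos rfl]
  field_simp
  ring

theorem summable_C₃_bound : Summable fun n : ℕ => 1 / ((2 * (n : ℝ) + 1) * (2 * n + 3)) := by
  have h := (summable_nat_add_iff 1).mpr (Real.summable_one_div_nat_pow.mpr one_lt_two)
  refine .of_nonneg_of_le (fun n => by positivity) (fun n => ?_) h
  gcongr
  push_cast
  nlinarith [(Nat.cast_nonneg n : (0 : ℝ) ≤ n)]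

/-- The factors at `q < 1` are closer to `1` than those at `q = 1`; this bound is the majorant for
the limit `q → 1`. -/
theorem C₃Factor_bounds {q : ℝ} (h0 : 0 < q) (h1 : q ≤ 1) (n : ℕ) :
    ‖C₃Factor q n - 1‖ ≤ 1 / ((2 * n + 1) * (2 * n + 3)) := by
  rcases eq_or_lt_of_le h1 with rfl | h1
  · rw [C₃Factor_one, add_sub_cancel_left, Real.norm_of_nonneg (by positivity)]
  have p1 : 0 < 1 - q ^ (4 * n + 2) := one_sub_pow_pos h0 h1 _ (by omega)
  have p2 : 0 < 1 - q ^ (4 * n + 6) := one_sub_pow_pos h0 h1 _ (by omega)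
  have hv : 0 ≤ q ^ 2 := sq_nonneg q
  have hv1 : q ^ 2 ≤ 1 := pow_le_one₀ h0.le h1.le
  have i1 := mul_pow_mul_one_sub_le hv hv1 n
  have i2 := mul_pow_mul_one_sub_le hv hv1 (n + 1)
  have e : C₃Factor q n - 1 =
      (q ^ 2) ^ (2 * n + 1) * (1 - q ^ 2) ^ 2 / ((1 - q ^ (4 * n + 2)) * (1 - q ^ (4 * n + 6))) := by
    rw [C₃Factor, if_neg h1.ne, div_sub_one (mul_pos p1 p2).ne']
    ring
  rw [e, Real.norm_of_nonneg (by positivity), div_le_div_iff₀ (mul_pos p1 p2) (by positivity)]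
  have j1 : (1 : ℝ) - (q ^ 2) ^ (2 * n + 1) = 1 - q ^ (4 * n + 2) := by rw [← pow_mul]; ring
  have j2 : (1 : ℝ) - (q ^ 2) ^ (2 * (n + 1) + 1) = 1 - q ^ (4 * n + 6) := by rw [← pow_mul]; ring
  rw [j1] at i1
  rw [j2] at i2
  push_cast at i2
  have h := mul_le_mul i1 i2 (by have := sub_nonneg.mpr hv1; positivity) p1.le
  calc _ = (2 * (n : ℝ) + 1) * (q ^ 2) ^ n * (1 - q ^ 2) *
        ((2 * ((n : ℝ) + 1) + 1) * (q ^ 2) ^ (n + 1) * (1 - q ^ 2)) := by ring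
    _ ≤ _ := by rwa [one_mul]

theorem multipliable_C₃Factor {q : ℝ} (h0 : 0 < q) (h1 : q ≤ 1) : Multipliable (C₃Factor q) := by
  have : Summable fun n => ‖C₃Factor q n - 1‖ :=
    .of_nonneg_of_le (fun _ => norm_nonneg _) (C₃Factor_bounds h0 h1) summable_C₃_bound
  simpa using multipliable_one_add_of_summable this

theorem C₃_one : C₃ 1 = Real.sqrt Real.pi := by
  have h : ∏' n, C₃Factor 1 n = Real.pi / 2 := by
    refine tendsto_nhds_unique (multipliable_C₃Factor one_pos le_rfl).hasProd.tendsto_prod_nat ?_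
    refine Real.tendsto_prod_pi_div_two.congr fun N => Finset.prod_congr rfl fun n _ => ?_
    rw [C₃Factor, if_pos rfl]
    field_simp
    ring
  rw [C₃, if_pos rfl, h]
  congr 1
  ring

/-- The limiting value of `qRatio`: both numerator and denominator are divided by `1 - q`, which
turns them into difference quotients of powers at `1`. -/
theorem tendsto_one_sub_rpow_div (a : ℂ) {b : ℂ} (hb : b ≠ 0) :
    Tendsto (fun q : ℝ => (1 - (q : ℂ) ^ a) / (1 - (q : ℂ) ^ b)) (𝓝[<] 1) (𝓝 (a / b)) := by
  have key (c : ℂ) : Tendsto (fun q : ℝ => (1 - (q : ℂ) ^ c) / (1 - (q : ℂ))) (𝓝[<] 1) (𝓝 c) := by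
    have h : HasDerivAt (fun z : ℂ => z ^ c) c ((1 : ℝ) : ℂ) := by
      have := (hasDerivAt_id (1 : ℂ)).cpow_const (c := c) (by simp)
      simpa using this
    have h' := h.comp_ofReal.tendsto_slope
    have h'' := h'.mono_left (nhdsWithin_mono 1 (fun x (hx : x < 1) => ne_of_lt hx))
    refine h''.congr fun q => ?_
    rw [slope_def_module]
    simp
    rw [← neg_sub (1 : ℂ) (q : ℂ), ← neg_sub (1 : ℂ) ((q : ℂ) ^ c), inv_neg, neg_mul_neg,
      div_eq_inv_mul]
  refine ((key a).div (key b) hb).congr' ?_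
  filter_upwards [self_mem_nhdsWithin] with q hq
  have : (1 : ℂ) - q ≠ 0 := by
    rw [sub_ne_zero]
    exact_mod_cast (ne_of_lt hq).symm
  rw [Pi.div_apply, div_div_div_cancel_right₀ this]

theorem tendsto_one_sub_pow_div_one_sub_pow (a : ℕ) {b : ℕ} (hb : b ≠ 0) :
    Tendsto (fun q : ℝ => (1 - q ^ a) / (1 - q ^ b)) (𝓝[<] 1) (𝓝 (a / b)) := by
  have h := tendsto_one_sub_rpow_div (a : ℂ) (b := b) (by exact_mod_cast hb)
  simp only [Complex.cpow_natCast] at h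
  have h' := (Complex.continuous_re.tendsto _).comp h
  have e : ((a : ℂ) / b).re = (a : ℝ) / b := by
    rw [← Complex.ofReal_re ((a : ℝ) / b)]
    push_cast
    rfl
  rw [e] at h'
  refine h'.congr fun q => ?_
  rw [Function.comp_apply, ← Complex.ofReal_re ((1 - q ^ a) / (1 - q ^ b))]
  push_cast
  rfl

theorem tendsto_C₃Factor (n : ℕ) :
    Tendsto (fun q => C₃Factor q n) (𝓝[<] 1) (𝓝 (C₃Factor 1 n)) := by
  have h := (tendsto_one_sub_pow_div_one_sub_pow (4 * n + 4) (b := 4 * n + 2) (by omega)).mul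
    (tendsto_one_sub_pow_div_one_sub_pow (4 * n + 4) (b := 4 * n + 6) (by omega))
  rw [C₃Factor, if_pos rfl]
  push_cast at h
  rw [div_mul_div_comm, ← sq] at h
  refine h.congr' ?_
  filter_upwards [self_mem_nhdsWithin] with q hq
  rw [C₃Factor, if_neg (ne_of_lt hq), div_mul_div_comm, ← sq]

theorem tendsto_C₃ : Tendsto C₃ (𝓝[<] 1) (𝓝 (Real.sqrt Real.pi)) := by
  rw [← C₃_one]
  have hprod : Tendsto (fun q => ∏' n, (1 + (C₃Factor q n - 1))) (𝓝[<] 1)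
      (𝓝 (∏' n, (1 + (C₃Factor 1 n - 1)))) := by
    refine tendsto_tprod_one_add_of_dominated_convergence summable_C₃_bound
      (fun n => (tendsto_C₃Factor n).sub_const 1) ?_
    filter_upwards [Ioo_mem_nhdsLT one_pos] with q hq
    exact C₃Factor_bounds hq.1 hq.2.le
  simp only [add_sub_cancel] at hprod
  have h4 := tendsto_one_sub_pow_div_one_sub_pow 4 two_ne_zero
  refine ((h4.mul hprod).sqrt).congr' ?_ |>.trans_eq ?_
  · filter_upwards [self_mem_nhdsWithin] with q hq
    rw [C₃, if_neg (ne_of_lt hq)]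
  · rw [C₃, if_pos rfl]
    norm_num

/-- The product in `C₃(q)` is the square of `∏ (1-q^{4n+4})/(1-q^{4n+2})` up to a telescoping
product with value `1 - q²`, so that the square root can be taken. -/
theorem C₃_eq_qPoch {q : ℝ} (h0 : 0 < q) (h1 : q < 1) :
    (C₃ q : ℂ) = Real.sqrt (1 - q ^ 4) *
      (qPoch ((q : ℂ) ^ 4) ((q : ℂ) ^ 4) / qPoch ((q : ℂ) ^ 2) ((q : ℂ) ^ 4)) := by
  have hp := norm_ofReal_pow_lt_one h0 h1 4 four_ne_zero
  have hpos (m : ℕ) (hm : m ≠ 0) : 0 < 1 - q ^ m := one_sub_pow_pos h0 h1 m hm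
  set r : ℕ → ℝ := fun n => (1 - q ^ (4 * n + 4)) / (1 - q ^ (4 * n + 2)) with hr
  have hrpos (n : ℕ) : 0 < r n := div_pos (hpos _ (by omega)) (hpos _ (by omega))
  have hne (n : ℕ) : 1 - (q : ℂ) ^ 2 * ((q : ℂ) ^ 4) ^ n ≠ 0 := by
    rw [← pow_mul, ← pow_add]
    exact one_sub_pow_ne_zero (norm_ofReal_lt_one h0 h1) _ (by omega)
  have hC := (hasProd_qPoch_div hp ((q : ℂ) ^ 4) hne).tendsto_prod_nat
  set E := qPoch ((q : ℂ) ^ 4) ((q : ℂ) ^ 4) / qPoch ((q : ℂ) ^ 2) ((q : ℂ) ^ 4)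
  have hC' : Tendsto (fun N => ((∏ n ∈ Finset.range N, r n : ℝ) : ℂ)) atTop (𝓝 E) := by
    refine hC.congr fun N => ?_
    push_cast
    refine Finset.prod_congr rfl fun n _ => ?_
    rw [hr]
    push_cast
    ring
  have hR : Tendsto (fun N => ∏ n ∈ Finset.range N, r n) atTop (𝓝 E.re) := by
    refine ((Complex.continuous_re.tendsto _).comp hC').congr fun N => ?_
    rw [Function.comp_apply, Complex.ofReal_re]
  have hE : E = (E.re : ℂ) :=
    tendsto_nhds_unique hC' ((Complex.continuous_ofReal.tendsto _).comp hR)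
  have hR0 : 0 ≤ E.re := ge_of_tendsto' hR fun N => Finset.prod_nonneg fun n _ => (hrpos n).le
  have hpart (N : ℕ) : ∏ n ∈ Finset.range N, C₃Factor q n =
      (∏ n ∈ Finset.range N, r n) ^ 2 * ((1 - q ^ 2) / (1 - q ^ (4 * N + 2))) := by
    induction N with
    | zero => simp [(hpos 2 two_ne_zero).ne']
    | succ N ih =>
      rw [Finset.prod_range_succ, ih, Finset.prod_range_succ, C₃Factor, if_neg h1.ne]
      have a1 := (hpos (4 * N + 2) (by omega)).ne'
      have a2 := (hpos (4 * N + 6) (by omega)).ne'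
      have e : 4 * (N + 1) + 2 = 4 * N + 6 := by ring
      have hrN : r N = (1 - q ^ (4 * N + 4)) / (1 - q ^ (4 * N + 2)) := rfl
      rw [e, hrN]
      generalize ∏ n ∈ Finset.range N, r n = R
      generalize 1 - q ^ (4 * N + 2) = d1 at *
      generalize 1 - q ^ (4 * N + 6) = d2 at *
      field_simp
  have hpow : Tendsto (fun N : ℕ => 1 - q ^ (4 * N + 2)) atTop (𝓝 1) := by
    have : Tendsto (fun N : ℕ => q ^ (4 * N + 2)) atTop (𝓝 0) :=
      (tendsto_pow_atTop_nhds_zero_of_lt_one h0.le h1).comp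
        (tendsto_atTop_mono (fun n => by simp only [id]; omega) tendsto_id)
    simpa using this.const_sub 1
  have htprod : ∏' n, C₃Factor q n = E.re ^ 2 * (1 - q ^ 2) := by
    refine tendsto_nhds_unique (multipliable_C₃Factor h0 h1.le).hasProd.tendsto_prod_nat ?_
    have := (hR.pow 2).mul ((tendsto_const_nhds (x := 1 - q ^ 2)).div hpow one_ne_zero)
    rw [div_one] at this
    exact this.congr fun N => (hpart N).symm
  have h2 := (hpos 2 two_ne_zero).ne'
  rw [hE, C₃, if_neg h1.ne, htprod, ← Complex.ofReal_mul]
  congr 1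
  rw [show (1 - q ^ 4) / (1 - q ^ 2) * (E.re ^ 2 * (1 - q ^ 2)) = (1 - q ^ 4) * E.re ^ 2 by
    field_simp, Real.sqrt_mul (hpos 4 four_ne_zero).le, Real.sqrt_sq hR0]

/-! ### The evaluations of `f(q^{2s},q)` -/

theorem qRatio_of_ne {q : ℝ} (hq : q ≠ 1) (a b : ℂ) :
    qRatio a b q = (1 - (q : ℂ) ^ a) / (1 - (q : ℂ) ^ b) := if_neg hq

theorem qRatio_one (a b : ℂ) : qRatio a b 1 = a / b := if_pos rfl

theorem qRatio_odd_even {q : ℝ} (hq : q ≠ 1) (j : ℕ) :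
    qRatio (2 * j + 1) (2 * j + 2) q =
      (1 - (q : ℂ) ^ (2 * j + 1)) / (1 - (q : ℂ) ^ (2 * j + 2)) := by
  rw [qRatio_of_ne hq]
  norm_cast

theorem fTerm_eq_qTerm {q : ℝ} (hq : q ≠ 1) (x : ℂ) (n : ℕ) : fTerm x q n = qTerm q x n := by
  rw [fTerm, qTerm]
  congr 1
  exact Finset.prod_congr rfl fun j _ => by rw [qRatio_odd_even hq]

theorem fTerm_zero_left (q : ℝ) (n : ℕ) : fTerm 0 q n =
    (-1) ^ n * (q : ℂ) ^ n * ∏ j ∈ Finset.range n, qRatio (2 * j + 1) (2 * j + 2) q := by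
  simp [fTerm]

theorem fTerm_zero_one (n : ℕ) : fTerm 0 1 n = (-1) ^ n * (centralCoeff n : ℂ) := by
  simp [fTerm_zero_left, centralCoeff, qRatio_one]

theorem cpow_two_mul_add {q : ℝ} (h0 : 0 < q) (s : ℂ) (m : ℕ) :
    (q : ℂ) ^ (2 * s + m) = (q : ℂ) ^ m * (q : ℂ) ^ (2 * s) := by
  rw [Complex.cpow_add _ _ (by exact_mod_cast h0.ne'), Complex.cpow_natCast, mul_comm]

theorem fPowTerm_eq {q : ℝ} (h0 : 0 < q) (s : ℂ) (n : ℕ) : fPowTerm s q n =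
    (-1) ^ n * (q : ℂ) ^ n * ∏ j ∈ Finset.range n, qRatio (2 * j + 1) (2 * j + 2) q *
      qRatio (2 * s + 2 * j + 1) (2 * s + 2 * j + 2) q := by
  rw [fPowTerm]
  split_ifs with hq
  · subst hq
    simp [qRatio_one, div_mul_div_comm]
  · rw [fTerm]
    congr 1
    refine Finset.prod_congr rfl fun j _ => ?_
    rw [qRatio_of_ne hq (2 * s + 2 * j + 1), mul_comm, ← cpow_two_mul_add h0,
      ← cpow_two_mul_add h0]
    push_cast
    simp only [add_assoc]

theorem one_sub_pow_mul_cpow_ne_zero {q : ℝ} {s : ℂ} (h0 : 0 < q)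
    (h : ∀ j : ℕ, (q : ℂ) ^ (2 * s + 2 * ((j : ℂ) + 1)) ≠ 1) (j : ℕ) :
    1 - (q : ℂ) ^ (2 * j + 2) * (q : ℂ) ^ (2 * s) ≠ 0 := by
  rw [← cpow_two_mul_add h0, sub_ne_zero]
  convert (h j).symm using 2
  push_cast
  ring

theorem prodFactor_eq_of_ne {q : ℝ} (h0 : 0 < q) (hq : q ≠ 1) (s : ℂ) (k : ℕ) :
    prodFactor s q k = (1 - (q : ℂ) ^ (4 * k + 3) * (q : ℂ) ^ (2 * s)) ^ 2 /
      ((1 - (q : ℂ) ^ (4 * k + 2) * (q : ℂ) ^ (2 * s)) *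
        (1 - (q : ℂ) ^ (4 * k + 4) * (q : ℂ) ^ (2 * s))) := by
  rw [prodFactor, qRatio_of_ne hq, qRatio_of_ne hq, div_mul_div_comm, ← sq]
  simp only [← cpow_two_mul_add h0]
  push_cast
  simp only [add_assoc]

theorem hasProd_prodFactor {q : ℝ} {s : ℂ} (h0 : 0 < q) (h1 : q < 1)
    (h : ∀ j : ℕ, (q : ℂ) ^ (2 * s + 2 * ((j : ℂ) + 1)) ≠ 1) :
    HasProd (prodFactor s q) (qPoch ((q : ℂ) ^ 3 * (q : ℂ) ^ (2 * s)) ((q : ℂ) ^ 4) ^ 2 /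
      (qPoch ((q : ℂ) ^ 2 * (q : ℂ) ^ (2 * s)) ((q : ℂ) ^ 4) *
        qPoch ((q : ℂ) ^ 4 * (q : ℂ) ^ (2 * s)) ((q : ℂ) ^ 4))) := by
  have hx := one_sub_pow_mul_cpow_ne_zero h0 h
  set x := (q : ℂ) ^ (2 * s)
  have e (m n : ℕ) : (q : ℂ) ^ m * x * ((q : ℂ) ^ 4) ^ n = (q : ℂ) ^ (4 * n + m) * x := by ring
  have hp := norm_ofReal_pow_lt_one h0 h1 4 four_ne_zero
  have h2 (n : ℕ) : 1 - (q : ℂ) ^ 2 * x * ((q : ℂ) ^ 4) ^ n ≠ 0 := by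
    rw [e]
    convert hx (2 * n) using 4
    ring
  have h4 (n : ℕ) : 1 - (q : ℂ) ^ 4 * x * ((q : ℂ) ^ 4) ^ n ≠ 0 := by
    rw [e]
    convert hx (2 * n + 1) using 4
    ring
  have := (hasProd_qPoch_div hp ((q : ℂ) ^ 3 * x) h2).mul
    (hasProd_qPoch_div hp ((q : ℂ) ^ 3 * x) h4)
  rw [div_mul_div_comm, ← sq] at this
  refine this.congr_fun fun n => ?_
  rw [prodFactor_eq_of_ne h0 h1.ne, div_mul_div_comm, ← sq, e, e, e]

theorem ofReal_pow_cpow {q : ℝ} (h0 : 0 < q) (m : ℕ) (a : ℂ) :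
    ((q ^ m : ℝ) : ℂ) ^ a = (q : ℂ) ^ (m * a) := by
  have hq : (q : ℂ) ≠ 0 := by exact_mod_cast h0.ne'
  have hq' : ((q ^ m : ℝ) : ℂ) ≠ 0 := by exact_mod_cast (pow_pos h0 m).ne'
  rw [Complex.cpow_def_of_ne_zero hq, Complex.cpow_def_of_ne_zero hq',
    ← Complex.ofReal_log (pow_pos h0 m).le, ← Complex.ofReal_log h0.le, Real.log_pow]
  push_cast
  ring_nf

theorem qFactorial_pow {q : ℝ} (h0 : 0 < q) (h1 : q < 1) {m : ℕ} (hm : m ≠ 0) (α : ℂ) :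
    qFactorial α (q ^ m) = 1 / ((1 - q ^ m : ℝ) : ℂ) ^ α *
      (qPoch ((q : ℂ) ^ m) ((q : ℂ) ^ m) / qPoch ((q : ℂ) ^ (m * α + m)) ((q : ℂ) ^ m)) := by
  have hq : (q : ℂ) ≠ 0 := by exact_mod_cast h0.ne'
  rw [qFactorial, if_neg (pow_lt_one₀ h0.le h1 hm).ne,
    ← tprod_qPoch_div (norm_ofReal_pow_lt_one h0 h1 m hm)]
  congr 1
  refine tprod_congr fun n => ?_
  have e : (m : ℂ) * (α + (n + 1)) = (m * α + m) + ((m * n : ℕ) : ℂ) := by push_cast; ring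
  rw [ofReal_pow_cpow h0, e, Complex.cpow_add _ _ hq, Complex.cpow_natCast, pow_mul,
    Complex.ofReal_pow, pow_succ']

/-- The second evaluation for `q < 1`, as an identity of `q`-Pochhammer symbols to the base `q⁴`. -/
theorem tprod_prodFactor_lt_one {q : ℝ} {s : ℂ} (h0 : 0 < q) (h1 : q < 1)
    (h : ∀ j : ℕ, (q : ℂ) ^ (2 * s + 2 * ((j : ℂ) + 1)) ≠ 1) :
    ∏' n, prodFactor s q n = (C₃ q : ℂ) / (1 + (q : ℂ) ^ 2) ^ s *
      (qFactorial s (q ^ 2) / qFactorial ((2 * s - 1) / 4) (q ^ 4) ^ 2) := by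
  have hx := one_sub_pow_mul_cpow_ne_zero h0 h
  have hp2 := norm_ofReal_pow_lt_one h0 h1 2 two_ne_zero
  have hp4 := norm_ofReal_pow_lt_one h0 h1 4 four_ne_zero
  have p2 := one_sub_pow_pos h0 h1 2 two_ne_zero
  have p4 := one_sub_pow_pos h0 h1 4 four_ne_zero
  have p2' : 0 < 1 + q ^ 2 := by positivity
  have ne4 (m : ℕ) (hm : m ≠ 0) : qPoch ((q : ℂ) ^ m) ((q : ℂ) ^ 4) ≠ 0 := by
    refine qPoch_ne_zero hp4 fun n => ?_
    rw [← pow_mul, ← pow_add]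
    exact one_sub_pow_ne_zero (norm_ofReal_lt_one h0 h1) _ (by omega)
  rw [(hasProd_prodFactor h0 h1 h).tprod_eq, C₃_eq_qPoch h0 h1,
    qFactorial_pow h0 h1 two_ne_zero, qFactorial_pow h0 h1 four_ne_zero]
  have e2 : (q : ℂ) ^ (((2 : ℕ) : ℂ) * s + (2 : ℕ)) = (q : ℂ) ^ 2 * (q : ℂ) ^ (2 * s) := by
    rw [← cpow_two_mul_add h0, Nat.cast_ofNat]
  have e4 : (q : ℂ) ^ (((4 : ℕ) : ℂ) * ((2 * s - 1) / 4) + (4 : ℕ)) =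
      (q : ℂ) ^ 3 * (q : ℂ) ^ (2 * s) := by
    rw [← cpow_two_mul_add h0]
    congr 1
    push_cast
    ring
  -- separate the even and the odd factors of the products to the base `q²`
  rw [e2, e4, qPoch_eq_mul hp2 ((q : ℂ) ^ 2), qPoch_eq_mul hp2 ((q : ℂ) ^ 2 * (q : ℂ) ^ (2 * s)),
    ← pow_mul, mul_right_comm, ← pow_add]
  rw [show 2 * 2 = 4 from rfl, show 2 + 2 = 4 from rfl]
  -- the powers of `1 - q²`, `1 + q²` and `1 - q⁴` cancel
  have hpow : (Real.sqrt (1 - q ^ 4) : ℂ) * (((1 - q ^ 4 : ℝ) : ℂ) ^ ((2 * s - 1) / 4)) ^ 2 =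
      (1 + (q : ℂ) ^ 2) ^ s * ((1 - q ^ 2 : ℝ) : ℂ) ^ s := by
    have c4 : ((1 - q ^ 4 : ℝ) : ℂ) ≠ 0 := by exact_mod_cast p4.ne'
    have c : (1 + (q : ℂ) ^ 2) = ((1 + q ^ 2 : ℝ) : ℂ) := by push_cast; rfl
    rw [Real.sqrt_eq_rpow, Complex.ofReal_cpow p4.le, ← Complex.cpow_nat_mul,
      ← Complex.cpow_add _ _ c4, c, ← Complex.mul_cpow_ofReal_nonneg p2'.le p2.le,
      ← Complex.ofReal_mul]
    congr 1
    · congr 1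
      ring
    · push_cast
      ring
  have hX2 : qPoch ((q : ℂ) ^ 2 * (q : ℂ) ^ (2 * s)) ((q : ℂ) ^ 4) ≠ 0 := by
    refine qPoch_ne_zero hp4 fun n => ?_
    convert hx (2 * n) using 2
    ring
  have hX4 : qPoch ((q : ℂ) ^ 4 * (q : ℂ) ^ (2 * s)) ((q : ℂ) ^ 4) ≠ 0 := by
    refine qPoch_ne_zero hp4 fun n => ?_
    convert hx (2 * n + 1) using 2
    ring
  have n1 : (1 + (q : ℂ) ^ 2) ^ s ≠ 0 := by
    rw [Complex.cpow_ne_zero_iff]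
    left
    exact_mod_cast p2'.ne'
  have n2 : ((1 - q ^ 2 : ℝ) : ℂ) ^ s ≠ 0 := by
    rw [Complex.cpow_ne_zero_iff]
    left
    exact_mod_cast p2.ne'
  have a2 := ne4 2 two_ne_zero
  have a4 := ne4 4 four_ne_zero
  have n4 : ((1 - q ^ 4 : ℝ) : ℂ) ^ ((2 * s - 1) / 4) ≠ 0 := by
    rw [Complex.cpow_ne_zero_iff]
    left
    exact_mod_cast p4.ne'
  generalize (Real.sqrt (1 - q ^ 4) : ℂ) = r at *
  generalize ((1 - q ^ 4 : ℝ) : ℂ) ^ ((2 * s - 1) / 4) = c at *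
  generalize ((1 - q ^ 2 : ℝ) : ℂ) ^ s = c2 at *
  generalize (1 + (q : ℂ) ^ 2) ^ s = d at *
  generalize qPoch ((q : ℂ) ^ 2 * (q : ℂ) ^ (2 * s)) ((q : ℂ) ^ 4) = X2 at *
  generalize qPoch ((q : ℂ) ^ 3 * (q : ℂ) ^ (2 * s)) ((q : ℂ) ^ 4) = X3 at *
  generalize qPoch ((q : ℂ) ^ 4 * (q : ℂ) ^ (2 * s)) ((q : ℂ) ^ 4) = X4 at *
  generalize qPoch ((q : ℂ) ^ 2) ((q : ℂ) ^ 4) = A2 at *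
  generalize qPoch ((q : ℂ) ^ 4) ((q : ℂ) ^ 4) = A4 at *
  -- at a pole of `((2s-1)/4)!` to the base `q⁴` both sides vanish
  by_cases hX3 : X3 = 0
  · simp [hX3]
  · field_simp
    linear_combination -hpow

theorem prodFactor_one (s : ℂ) (k : ℕ) : prodFactor s 1 k =
    (2 * s + 4 * k + 3) ^ 2 / ((2 * s + 4 * k + 2) * (2 * s + 4 * k + 4)) := by
  rw [prodFactor, qRatio_one, qRatio_one, div_mul_div_comm, sq]

theorem multipliable_prodFactor_one {s : ℂ} (hs : ∀ j : ℕ, s ≠ -((j : ℂ) + 1)) :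
    Multipliable (prodFactor s 1) := by
  have hb : Summable fun n : ℕ => 1 / ((n + 1 : ℕ) : ℝ) ^ 2 :=
    (summable_nat_add_iff 1).mpr (Real.summable_one_div_nat_pow.mpr one_lt_two)
  have h : Summable fun k : ℕ => ‖1 / ((2 * s + 4 * k + 2) * (2 * s + 4 * k + 4))‖ := by
    refine Summable.norm (.of_norm_bounded_eventually_nat hb ?_)
    obtain ⟨M, hM⟩ := exists_nat_ge ‖2 * s‖
    filter_upwards [eventually_ge_atTop M] with k hk
    have hk' : (M : ℝ) ≤ k := by exact_mod_cast hk
    have key (c : ℕ) (hc : 2 ≤ c) : ((k + 1 : ℕ) : ℝ) ≤ ‖2 * s + 4 * k + c‖ := by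
      have h1 := norm_sub_norm_le (4 * (k : ℂ) + c) (-(2 * s))
      have h2 : ‖4 * (k : ℂ) + c‖ = 4 * k + c := by
        exact_mod_cast Complex.norm_natCast (4 * k + c)
      have hc' : (2 : ℝ) ≤ c := by exact_mod_cast hc
      rw [h2, norm_neg, show 4 * (k : ℂ) + c - -(2 * s) = 2 * s + 4 * k + c by ring] at h1
      push_cast
      linarith [(Nat.cast_nonneg k : (0 : ℝ) ≤ k)]
    have k2 := key 2 le_rfl
    have k4 := key 4 (by norm_num)
    rw [norm_div, norm_one, norm_mul, sq]
    exact one_div_le_one_div_of_le (by positivity)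
      (mul_le_mul k2 k4 (by positivity) (norm_nonneg _))
  refine (multipliable_one_add_of_summable h).congr fun k => ?_
  have h2 : 2 * s + 4 * k + 2 ≠ 0 := by
    convert two_mul_add_ne_zero_of_ne hs (2 * k) using 1
    push_cast
    ring
  have h4 : 2 * s + 4 * k + 4 ≠ 0 := by
    convert two_mul_add_ne_zero_of_ne hs (2 * k + 1) using 1
    push_cast
    ring
  rw [prodFactor_one, eq_div_iff (mul_ne_zero h2 h4), add_mul, one_div,
    inv_mul_cancel₀ (mul_ne_zero h2 h4)]
  ring

theorem tprod_prodFactor_one {s : ℂ} (hs : ∀ j : ℕ, s ≠ -((j : ℂ) + 1)) :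
    ∏' n, prodFactor s 1 n = gammaProd s := by
  refine tendsto_nhds_unique (multipliable_prodFactor_one hs).hasProd.tendsto_prod_nat ?_
  simpa only [prodFactor_one] using tendsto_prod_gammaProd hs

theorem tendsto_fTerm_zero_one_sum :
    Tendsto (fun N => ∑ n ∈ Finset.range N, fTerm 0 1 n) atTop (𝓝 (1 / (Real.sqrt 2 : ℂ))) := by
  simpa only [fTerm_zero_one, centralCoeff_sum_eq] using tendsto_centralCoeff_sum

theorem fPowTerm_one (s : ℂ) (n : ℕ) : fPowTerm s 1 n = oneTerm s n := if_pos rfl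

theorem f_zero_one : f 0 1 = 1 / (Real.sqrt 2 : ℂ) := tendsto_fTerm_zero_one_sum.limUnder_eq

theorem tendsto_fTerm_sum_lt_one {q : ℝ} (h0 : 0 < q) (h1 : q < 1) (x : ℂ) :
    Tendsto (fun N => ∑ n ∈ Finset.range N, fTerm x q n) atTop (𝓝 (∑' n, qTerm q x n)) := by
  simp only [fTerm_eq_qTerm h1.ne]
  exact (summable_qTerm (norm_ofReal_lt_one h0 h1) x).hasSum.tendsto_sum_nat

theorem tendsto_fTerm_zero_sum {q : ℝ} (h0 : 0 < q) (h1 : q ≤ 1) :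
    Tendsto (fun N => ∑ n ∈ Finset.range N, fTerm 0 q n) atTop (𝓝 (f 0 q)) := by
  refine tendsto_nhds_limUnder ?_
  rcases eq_or_lt_of_le h1 with rfl | h1
  · exact ⟨_, tendsto_fTerm_zero_one_sum⟩
  · exact ⟨_, tendsto_fTerm_sum_lt_one h0 h1 0⟩

/-- Convergence and first evaluation, for `q < 1` and `q = 1` alike. -/
theorem tendsto_fPowTerm_sum {q : ℝ} {s : ℂ} (h0 : 0 < q) (h1 : q ≤ 1)
    (hs : ∀ j : ℕ, s ≠ -((j : ℂ) + 1))
    (h : q < 1 → ∀ j : ℕ, (q : ℂ) ^ (2 * s + 2 * ((j : ℂ) + 1)) ≠ 1) :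
    Multipliable (prodFactor s q) ∧
      Tendsto (fun N => ∑ n ∈ Finset.range N, fPowTerm s q n) atTop
        (𝓝 (f 0 q * ∏' n, prodFactor s q n)) := by
  rcases eq_or_lt_of_le h1 with rfl | h1
  · refine ⟨multipliable_prodFactor_one hs, ?_⟩
    rw [f_zero_one, tprod_prodFactor_one hs]
    simpa only [fPowTerm_one] using tendsto_oneTerm_sum_gamma hs
  · have hP := hasProd_prodFactor h0 h1 (h h1)
    refine ⟨hP.multipliable, ?_⟩
    have hlim := hP.multipliable.hasProd.tendsto_prod_nat
    simp only [prodFactor_eq_of_ne h0 h1.ne s] at hlim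
    have hf : f 0 q = ∑' n, qTerm q 0 n := (tendsto_fTerm_sum_lt_one h0 h1 0).limUnder_eq
    simp only [fPowTerm, if_neg h1.ne]
    rw [hf, mul_comm (∑' n, qTerm (q : ℂ) 0 n)]
    simp only [prodFactor_eq_of_ne h0 h1.ne s]
    rw [← qTerm_sum_eq (norm_ofReal_lt_one h0 h1) (one_sub_pow_mul_cpow_ne_zero h0 (h h1)) hlim]
    exact tendsto_fTerm_sum_lt_one h0 h1 _

theorem fPow_eq_limUnder (s : ℂ) (q : ℝ) :
    fPow s q = limUnder atTop fun N : ℕ => ∑ n ∈ Finset.range N, fPowTerm s q n := by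
  rw [fPow]
  split_ifs with hq
  · rw [hq]
  · simp only [f, fPowTerm, if_neg hq]

theorem fPow_eq {q : ℝ} {s : ℂ} (h0 : 0 < q) (h1 : q ≤ 1)
    (hs : ∀ j : ℕ, s ≠ -((j : ℂ) + 1))
    (h : q < 1 → ∀ j : ℕ, (q : ℂ) ^ (2 * s + 2 * ((j : ℂ) + 1)) ≠ 1) :
    fPow s q = f 0 q * ∏' n, prodFactor s q n := by
  rw [fPow_eq_limUnder]
  exact (tendsto_fPowTerm_sum h0 h1 hs h).2.limUnder_eq

theorem tprod_prodFactor_eq {q : ℝ} {s : ℂ} (h0 : 0 < q) (h1 : q ≤ 1)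
    (hs : ∀ j : ℕ, s ≠ -((j : ℂ) + 1))
    (h : q < 1 → ∀ j : ℕ, (q : ℂ) ^ (2 * s + 2 * ((j : ℂ) + 1)) ≠ 1) :
    ∏' n, prodFactor s q n = (C₃ q : ℂ) / (1 + (q : ℂ) ^ 2) ^ s *
      (qFactorial s (q ^ 2) / qFactorial ((2 * s - 1) / 4) (q ^ 4) ^ 2) := by
  rcases eq_or_lt_of_le h1 with rfl | h1
  · rw [tprod_prodFactor_one hs, gammaProd_eq, C₃_one, one_pow, one_pow, qFactorial, qFactorial,
      if_pos rfl, if_pos rfl, Complex.ofReal_one, one_pow, one_add_one_eq_two]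
  · exact tprod_prodFactor_lt_one h0 h1 (h h1)

theorem tendsto_qRatio (a : ℂ) {b : ℂ} (hb : b ≠ 0) :
    Tendsto (qRatio a b) (𝓝[<] 1) (𝓝 (qRatio a b 1)) := by
  rw [qRatio_one]
  refine (tendsto_one_sub_rpow_div a hb).congr' ?_
  filter_upwards [self_mem_nhdsWithin] with q hq
  rw [qRatio_of_ne (ne_of_lt hq)]

theorem tendsto_fPowTerm {s : ℂ} (hs : ∀ j : ℕ, s ≠ -((j : ℂ) + 1)) (n : ℕ) :
    Tendsto (fun q : ℝ => fPowTerm s q n) (𝓝[<] 1) (𝓝 (fPowTerm s 1 n)) := by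
  rw [fPowTerm_eq one_pos]
  have hq : Tendsto (fun q : ℝ => (-1) ^ n * (q : ℂ) ^ n) (𝓝[<] 1)
      (𝓝 ((-1) ^ n * ((1 : ℝ) : ℂ) ^ n)) := by
    have : Continuous fun q : ℝ => (-1) ^ n * (q : ℂ) ^ n := by fun_prop
    exact (this.tendsto 1).mono_left nhdsWithin_le_nhds
  refine (hq.mul (tendsto_finsetProd _ fun (j : ℕ) _ => (tendsto_qRatio (2 * j + 1)
    (two_mul_natCast_add_two_ne_zero j)).mul (tendsto_qRatio (2 * s + 2 * j + 1)
    (two_mul_add_ne_zero_of_ne hs j)))).congr' ?_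
  filter_upwards [Ioo_mem_nhdsLT one_pos] with q hq
  rw [fPowTerm_eq hq.1]

/-! ### The elliptic integral -/

/-- The substitution `v = (t²/(2-t²))²`, a bijection of `(0,1)` that turns the elliptic integral into
a Beta integral. -/
def ellipticSubst (t : ℝ) : ℝ := (t ^ 2 / (2 - t ^ 2)) ^ 2

theorem two_sub_sq_pos {t : ℝ} (ht : t ∈ Set.Ioo (0 : ℝ) 1) : 0 < 2 - t ^ 2 := by
  nlinarith [ht.1, ht.2]

theorem hasDerivAt_ellipticSubst {t : ℝ} (ht : t ∈ Set.Ioo (0 : ℝ) 1) :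
    HasDerivAt ellipticSubst (8 * t ^ 3 / (2 - t ^ 2) ^ 3) t := by
  have h2 := (two_sub_sq_pos ht).ne'
  have hsq : HasDerivAt (fun t : ℝ => t ^ 2) (2 * t) t := by simpa using hasDerivAt_pow 2 t
  have := (hsq.div (hsq.const_sub 2) h2).pow 2
  refine this.congr_deriv ?_
  simp only [Pi.div_apply, Nat.cast_ofNat, Nat.add_one_sub_one, pow_one]
  generalize hd : 2 - t ^ 2 = d at *
  field_simp
  rw [← hd]
  ring

theorem injOn_ellipticSubst : Set.InjOn ellipticSubst (Set.Ioo 0 1) := by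
  intro t ht u hu h
  have ht2 := two_sub_sq_pos ht
  have hu2 := two_sub_sq_pos hu
  have h' : t ^ 2 / (2 - t ^ 2) = u ^ 2 / (2 - u ^ 2) :=
    (pow_left_inj₀ (by positivity) (by positivity) two_ne_zero).mp h
  rw [div_eq_div_iff ht2.ne' hu2.ne'] at h'
  exact (pow_left_inj₀ ht.1.le hu.1.le two_ne_zero).mp (by linarith)

theorem image_ellipticSubst : ellipticSubst '' Set.Ioo 0 1 = Set.Ioo 0 1 := by
  ext v
  constructor
  · rintro ⟨t, ht, rfl⟩
    have ht2 := two_sub_sq_pos ht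
    have h0 : 0 < t := ht.1
    have hw : t ^ 2 / (2 - t ^ 2) < 1 := by
      rw [div_lt_one ht2]
      nlinarith [ht.2]
    exact ⟨by unfold ellipticSubst; positivity, pow_lt_one₀ (by positivity) hw two_ne_zero⟩
  · rintro ⟨h0, h1⟩
    set r := Real.sqrt v with hr
    have hr0 : 0 < r := Real.sqrt_pos.mpr h0
    have hr1 : r < 1 := by
      rw [hr, Real.sqrt_lt' one_pos]
      simpa using h1
    have hsq : Real.sqrt (2 * r / (1 + r)) ^ 2 = 2 * r / (1 + r) := Real.sq_sqrt (by positivity)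
    refine ⟨Real.sqrt (2 * r / (1 + r)), ⟨Real.sqrt_pos.mpr (by positivity), ?_⟩, ?_⟩
    · rw [Real.sqrt_lt' one_pos, one_pow, div_lt_one (by positivity)]
      linarith
    · have : 2 * r / (1 + r) / (2 - 2 * r / (1 + r)) = r := by
        have e : 2 - 2 * r / (1 + r) = 2 / (1 + r) := by field_simp; ring
        rw [e]
        field_simp
      rw [ellipticSubst, hsq, this, Real.sq_sqrt h0.le]

/-- The integrand `(1-t²)^{-1/2} (2-t²)^{-1/2} (t²/(2-t²))^s`. -/
def ellipticIntegrand (s : ℂ) (t : ℝ) : ℂ :=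
  ((1 / (Real.sqrt (1 - t ^ 2) * Real.sqrt (2 - t ^ 2)) : ℝ) : ℂ) *
    ((t ^ 2 / (2 - t ^ 2) : ℝ) : ℂ) ^ s

/-- The integrand of `4 ∫ …` is the pullback of the integrand of the Beta function
`B(s/2 + 1/4, 1/2)`. -/
theorem abs_deriv_smul_beta_eq (s : ℂ) {t : ℝ} (ht : t ∈ Set.Ioo (0 : ℝ) 1) :
    |8 * t ^ 3 / (2 - t ^ 2) ^ 3| • ((ellipticSubst t : ℂ) ^ (s / 2 + 1 / 4 - 1) *
      (1 - (ellipticSubst t : ℂ)) ^ ((1 / 2 : ℂ) - 1)) = 4 * ellipticIntegrand s t := by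
  have h2 := two_sub_sq_pos ht
  have h0 : 0 < t := ht.1
  have h1 : 0 < 1 - t ^ 2 := by nlinarith [ht.2]
  set w := t ^ 2 / (2 - t ^ 2) with hw
  have hw0 : 0 < w := by positivity
  have hwc : (w : ℂ) ≠ 0 := by exact_mod_cast hw0.ne'
  have e1 : (ellipticSubst t : ℂ) ^ (s / 2 + 1 / 4 - 1) =
      (w : ℂ) ^ s * ((w ^ (-(3 / 2) : ℝ) : ℝ) : ℂ) := by
    rw [ellipticSubst, ← hw, ofReal_pow_cpow hw0, Complex.ofReal_cpow hw0.le,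
      ← Complex.cpow_add _ _ hwc]
    congr 1
    push_cast
    ring
  have e2 : (1 - (ellipticSubst t : ℂ)) ^ ((1 / 2 : ℂ) - 1) =
      (((2 - t ^ 2) / (2 * Real.sqrt (1 - t ^ 2)) : ℝ) : ℂ) := by
    have hE : 1 - ellipticSubst t = (2 * Real.sqrt (1 - t ^ 2) / (2 - t ^ 2)) ^ 2 := by
      rw [ellipticSubst, div_pow, div_pow, mul_pow, Real.sq_sqrt h1.le]
      field_simp
      ring
    have hp : 0 < 2 * Real.sqrt (1 - t ^ 2) / (2 - t ^ 2) := by positivity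
    have hc : (1 - (ellipticSubst t : ℂ)) =
        (((2 * Real.sqrt (1 - t ^ 2) / (2 - t ^ 2)) ^ 2 : ℝ) : ℂ) := by
      rw [← hE]
      push_cast
      rfl
    rw [hc, ofReal_pow_cpow hp, show (((2 : ℕ) : ℂ) * (1 / 2 - 1)) = -1 by push_cast; ring,
      Complex.cpow_neg_one, ← Complex.ofReal_inv, inv_div]
  have e3 : w ^ (-(3 / 2) : ℝ) = (2 - t ^ 2) * Real.sqrt (2 - t ^ 2) / t ^ 3 := by
    have hs : Real.sqrt w = t / Real.sqrt (2 - t ^ 2) := by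
      rw [hw, Real.sqrt_div' _ h2.le, Real.sqrt_sq h0.le]
    have : w ^ (3 / 2 : ℝ) = w * Real.sqrt w := by
      rw [show (3 / 2 : ℝ) = 1 + 1 / 2 by norm_num, Real.rpow_add hw0, Real.rpow_one,
        ← Real.sqrt_eq_rpow]
    rw [Real.rpow_neg hw0.le, this, hs, hw]
    field_simp
  have e4 : |8 * t ^ 3 / (2 - t ^ 2) ^ 3| * (w ^ (-(3 / 2) : ℝ)) *
      ((2 - t ^ 2) / (2 * Real.sqrt (1 - t ^ 2))) =
      4 * (1 / (Real.sqrt (1 - t ^ 2) * Real.sqrt (2 - t ^ 2))) := by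
    rw [abs_of_pos (by positivity), e3]
    have hs : Real.sqrt (2 - t ^ 2) ^ 2 = 2 - t ^ 2 := Real.sq_sqrt h2.le
    have hs0 : 0 < Real.sqrt (2 - t ^ 2) := Real.sqrt_pos.mpr h2
    field_simp
    rw [hs]
    ring
  rw [e1, e2, Complex.real_smul, ellipticIntegrand, ← hw]
  have e4' := congrArg (fun x : ℝ => (x : ℂ)) e4
  simp only [Complex.ofReal_mul] at e4'
  rw [← mul_assoc 4, show (4 : ℂ) = ((4 : ℝ) : ℂ) by norm_num, ← e4']
  ring

theorem betaParam_re_pos {s : ℂ} (hs : -1 / 2 < s.re) : 0 < (s / 2 + 1 / 4).re := by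
  have h1 : (s / 2).re = s.re / 2 := by simp
  have h2 : (1 / 4 : ℂ).re = 1 / 4 := by norm_num
  rw [Complex.add_re, h1, h2]
  linarith

theorem intervalIntegrable_ellipticIntegrand {s : ℂ} (hs : -1 / 2 < s.re) :
    IntervalIntegrable (ellipticIntegrand s) MeasureTheory.volume 0 1 := by
  have hB := Complex.betaIntegral_convergent (betaParam_re_pos hs) (v := 1 / 2) (by norm_num)
  rw [intervalIntegrable_iff_integrableOn_Ioo_of_le zero_le_one, ← image_ellipticSubst,
    MeasureTheory.integrableOn_image_iff_integrableOn_abs_deriv_smul measurableSet_Ioo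
      (fun t ht => (hasDerivAt_ellipticSubst ht).hasDerivWithinAt) injOn_ellipticSubst,
    MeasureTheory.integrableOn_congr_fun (fun t ht => abs_deriv_smul_beta_eq s ht)
      measurableSet_Ioo] at hB
  rw [intervalIntegrable_iff_integrableOn_Ioo_of_le zero_le_one]
  refine (hB.const_mul (1 / 4)).congr (.of_forall fun t => ?_)
  simp only
  ring

theorem integral_ellipticIntegrand (s : ℂ) :
    ∫ t in (0 : ℝ)..1, ellipticIntegrand s t =
      1 / 4 * Complex.betaIntegral (s / 2 + 1 / 4) (1 / 2) := by
  rw [Complex.betaIntegral, intervalIntegral.integral_of_le zero_le_one,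
    intervalIntegral.integral_of_le zero_le_one, MeasureTheory.integral_Ioc_eq_integral_Ioo,
    MeasureTheory.integral_Ioc_eq_integral_Ioo]
  conv_rhs => rw [← image_ellipticSubst]
  rw [MeasureTheory.integral_image_eq_integral_abs_deriv_smul measurableSet_Ioo
      (fun t ht => (hasDerivAt_ellipticSubst ht).hasDerivWithinAt) injOn_ellipticSubst,
    MeasureTheory.setIntegral_congr_fun measurableSet_Ioo
      (fun t ht => abs_deriv_smul_beta_eq s ht), MeasureTheory.integral_const_mul]
  ring

theorem ne_neg_natCast_of_re_pos {z : ℂ} (hz : 0 < z.re) (m : ℕ) : z ≠ -m := by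
  rintro rfl
  simp at hz
  linarith [(Nat.cast_nonneg m : (0 : ℝ) ≤ m)]

/-- Both sides are known: the integral is `B(s/2 + 1/4, 1/2) / 4` and the series is Kummer's
evaluation. They are compared by the duplication formula at `s/2 + 1/4` and at `s/2 + 1/2`. -/
theorem integral_ellipticIntegrand_eq_fPow {s : ℂ} (hs : -1 / 2 < s.re) :
    ∫ t in (0 : ℝ)..1, ellipticIntegrand s t =
      Complex.Gamma (1 / 2) * Complex.Gamma (s + 1 / 2) / (2 * Complex.Gamma (s + 1)) *
        fPow s 1 := by
  have hs' (j : ℕ) : s ≠ -((j : ℂ) + 1) := by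
    rintro rfl
    simp at hs
    linarith [(Nat.cast_nonneg j : (0 : ℝ) ≤ j)]
  have hre := betaParam_re_pos hs
  have hB := Complex.Gamma_mul_Gamma_eq_betaIntegral hre (t := 1 / 2) (by norm_num)
  rw [show s / 2 + 1 / 4 + 1 / 2 = s / 2 + 3 / 4 by ring] at hB
  have g34 : Complex.Gamma (s / 2 + 3 / 4) ≠ 0 := by
    refine Complex.Gamma_ne_zero (ne_neg_natCast_of_re_pos ?_)
    rw [show s / 2 + 3 / 4 = s / 2 + 1 / 4 + 1 / 2 by ring, Complex.add_re]
    have : (1 / 2 : ℂ).re = 1 / 2 := by norm_num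
    linarith
  have g1 : Complex.Gamma (s + 1) ≠ 0 := by
    refine Complex.Gamma_ne_zero fun m hm => ?_
    exact hs' m (by linear_combination hm)
  have hdup := Complex.Gamma_mul_Gamma_add_half (s / 2 + 1 / 4)
  rw [show s / 2 + 1 / 4 + 1 / 2 = s / 2 + 3 / 4 by ring,
    show 2 * (s / 2 + 1 / 4) = s + 1 / 2 by ring] at hdup
  have h2 : (2 : ℂ) ^ s ≠ 0 := by simp [Complex.cpow_eq_zero_iff]
  have hpow : (2 : ℂ) ^ (1 - (s + 1 / 2)) = Real.sqrt 2 / 2 ^ s := by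
    rw [show 1 - (s + 1 / 2) = 1 / 2 - s by ring, Complex.cpow_sub _ _ two_ne_zero]
    congr 1
    rw [Real.sqrt_eq_rpow, Complex.ofReal_cpow zero_le_two]
    push_cast
    rfl
  have hf : fPow s 1 = 1 / (Real.sqrt 2 : ℂ) * gammaProd s := by
    rw [fPow_eq one_pos le_rfl hs' (fun h => absurd h (lt_irrefl _)), f_zero_one,
      tprod_prodFactor_one hs']
  have hsq2 : (Real.sqrt 2 : ℂ) ^ 2 = 2 := by exact_mod_cast Real.sq_sqrt (zero_le_two (α := ℝ))
  have hsq0 : (Real.sqrt 2 : ℂ) ≠ 0 := by simp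
  rw [integral_ellipticIntegrand, hf, gammaProd, Gamma_half_add_half_mul_Gamma_half_add_one]
  rw [hpow] at hdup
  generalize Complex.betaIntegral (s / 2 + 1 / 4) (1 / 2) = B at *
  generalize Complex.Gamma (s / 2 + 3 / 4) = G3 at *
  generalize Complex.Gamma (s / 2 + 1 / 4) = G1 at *
  generalize Complex.Gamma (s + 1) = H at *
  generalize Complex.Gamma (s + 1 / 2) = H' at *
  generalize Complex.Gamma (1 / 2) = γ at *
  generalize (Real.sqrt Real.pi : ℂ) = ϖ at *
  generalize (2 : ℂ) ^ s = p at *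
  generalize (Real.sqrt 2 : ℂ) = r at *
  have hB' : B = G1 * γ / G3 := by rw [hB]; field_simp
  have hd' : H' * ϖ = G1 * G3 * p / r := by
    rw [hdup]; field_simp
  rw [hB']
  calc _ = (γ / (4 * G3 ^ 2)) * (G1 * G3) := by field_simp
    _ = (γ / (2 * r * p * G3 ^ 2)) * (G1 * G3 * p / r) := by
      field_simp
      rw [hsq2]
      ring
    _ = _ := by
      rw [← hd']
      field_simp

end QElliptic

end

theorem mainTheorem6 :
    (∀ (q : ℝ) (s : ℂ), 0 < q → q ≤ 1 →
      -- `s` is not a negative integer, and for `q < 1` no denominator `1 - q^{2s+2j}` vanishes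
      (∀ j : ℕ, s ≠ -((j : ℂ) + 1)) →
      (q < 1 → ∀ j : ℕ, (q : ℂ) ^ (2 * s + 2 * ((j : ℂ) + 1)) ≠ 1) →
      -- the series `f(0,q)` and `f(q^{2s},q)` and the infinite products converge
      Tendsto (fun N : ℕ => ∑ n ∈ Finset.range N, QElliptic.fTerm 0 q n) atTop
        (𝓝 (QElliptic.f 0 q)) ∧
      Tendsto (fun N : ℕ => ∑ n ∈ Finset.range N, QElliptic.fPowTerm s q n) atTop
        (𝓝 (QElliptic.fPow s q)) ∧
      Multipliable (QElliptic.prodFactor s q) ∧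
      Multipliable (QElliptic.C₃Factor q) ∧
      -- the two evaluations
      QElliptic.fPow s q = QElliptic.f 0 q * ∏' n : ℕ, QElliptic.prodFactor s q n ∧
      QElliptic.fPow s q =
        QElliptic.f 0 q * ((QElliptic.C₃ q : ℂ) / (1 + (q : ℂ) ^ 2) ^ s) *
          (QElliptic.qFactorial s (q ^ 2) /
            QElliptic.qFactorial ((2 * s - 1) / 4) (q ^ 4) ^ 2) ∧
      -- the first evaluation with both series written out
      ∃ A : ℂ,
        Tendsto (fun N : ℕ => ∑ n ∈ Finset.range N, (-1) ^ n * (q : ℂ) ^ n *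
          ∏ j ∈ Finset.range n, QElliptic.qRatio (2 * j + 1) (2 * j + 2) q) atTop (𝓝 A) ∧
        Tendsto (fun N : ℕ => ∑ n ∈ Finset.range N, (-1) ^ n * (q : ℂ) ^ n *
          ∏ j ∈ Finset.range n, QElliptic.qRatio (2 * j + 1) (2 * j + 2) q *
            QElliptic.qRatio (2 * s + 2 * j + 1) (2 * s + 2 * j + 2) q) atTop
          (𝓝 (A * ∏' n : ℕ, QElliptic.prodFactor s q n))) ∧
    -- the constants at `q = 1`; the value `C₃(1)` is also the limit of `C₃(q)`
    QElliptic.C₃ 1 = Real.sqrt Real.pi ∧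
    Tendsto QElliptic.C₃ (𝓝[<] 1) (𝓝 (Real.sqrt Real.pi)) ∧
    QElliptic.f 0 1 = 1 / (Real.sqrt 2 : ℂ) ∧
    -- the terms of `f(q^{2s},q)` are `q`-analogues of those of the series at `q = 1`
    (∀ s : ℂ, (∀ j : ℕ, s ≠ -((j : ℂ) + 1)) → ∀ n : ℕ,
      Tendsto (fun q : ℝ => QElliptic.fPowTerm s q n) (𝓝[<] 1)
        (𝓝 (QElliptic.fPowTerm s 1 n))) ∧
    -- the series at `q = 1` is the one that comes from the elliptic integral
    (∀ s : ℂ, -1 / 2 < s.re →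
      IntervalIntegrable
        (fun t : ℝ => ((1 / (Real.sqrt (1 - t ^ 2) * Real.sqrt (2 - t ^ 2)) : ℝ) : ℂ) *
          ((t ^ 2 / (2 - t ^ 2) : ℝ) : ℂ) ^ s) MeasureTheory.volume 0 1 ∧
      ∫ t in (0 : ℝ)..1, ((1 / (Real.sqrt (1 - t ^ 2) * Real.sqrt (2 - t ^ 2)) : ℝ) : ℂ) *
          ((t ^ 2 / (2 - t ^ 2) : ℝ) : ℂ) ^ s =
        Complex.Gamma (1 / 2) * Complex.Gamma (s + 1 / 2) / (2 * Complex.Gamma (s + 1)) *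
          QElliptic.fPow s 1) := by
  refine ⟨fun q s h0 h1 hs h => ?_, QElliptic.C₃_one, QElliptic.tendsto_C₃, QElliptic.f_zero_one,
    fun s hs n => QElliptic.tendsto_fPowTerm hs n, fun s hs =>
      ⟨QElliptic.intervalIntegrable_ellipticIntegrand hs,
        QElliptic.integral_ellipticIntegrand_eq_fPow hs⟩⟩
  obtain ⟨hmul, hlim⟩ := QElliptic.tendsto_fPowTerm_sum h0 h1 hs h
  have heval := QElliptic.fPow_eq h0 h1 hs h
  refine ⟨QElliptic.tendsto_fTerm_zero_sum h0 h1, heval ▸ hlim, hmul,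
    QElliptic.multipliable_C₃Factor h0 h1, heval, ?_, QElliptic.f 0 q, ?_, ?_⟩
  · rw [heval, QElliptic.tprod_prodFactor_eq h0 h1 hs h, mul_assoc]
  · simpa only [QElliptic.fTerm_zero_left] using QElliptic.tendsto_fTerm_zero_sum h0 h1
  · simpa only [QElliptic.fPowTerm_eq h0] using hlim
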